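/- **Setting.** Let $\beta>1$ be a Pisot unit: a real algebraic integer with minimal polynomial $x^d-c_1x^{d-1}-\cdots-c_d\in\mathbb Z[x]$, $|c_d|=1$, whose Galois conjugates $\beta_2,\dots,\beta_d$ other than $\beta_1=\beta$ satisfy $|\beta_j|<1$. Let $\Gamma_j:\mathbb Q(\beta)\to\mathbb Q(\beta_j)$ be the field isomorphism with $\Gamma_j(\beta)=\beta_j$. Let $A\subset\mathbb Q(\beta)$ be a non-empty finite set of real numbers, let $X_a$ ($a\in A$) be pairwise disjoint non-empty sets, each a finite union of intervals $[\ell,r)\subset\mathbb R$, let $X=\bigcup_{a\in A}X_a$, and assume $\bigcup_{a\in A}(\beta X_a-a)=X$. The right-continuous $\beta$-transformation $T:X\to X$ is $Tx=\beta x-a$ for $x\in X_a$. The $T$-expansion of $x\in X$ is the sequence $b_1(x)b_2(x)\cdots\in A^\omega$ with $b_k(x)=a$ if $T^{k-1}x\in X_a$; a sequence is $T$-admissible if it is the $T$-expansion of some $x\in X$. Let $$\mathcal S=\{(u_k)_{k\in\mathbb Z}\in A^{\mathbb Z}: u_ku_{k+1}\cdots\text{ is }T\text{-admissible for all }k\in\mathbb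 Z\}.$$ Let $M_\beta$ be the $d\times d$ companion matrix with first row $(c_1,\dots,c_d)$, ones directly below the diagonal and zeros elsewhere, and let $\mathbf v_j=\nu_j(\beta_j^{d-1},\dots,\beta_j,1)^t$ be its eigenvectors normalized by $\mathbf v_1+\cdots+\mathbf v_d=(1,0,\dots,0)^t$. Let $H\subset\mathbb R^d$ be the span of the real and imaginary parts of $\mathbf v_2,\dots,\mathbf v_d$, let $\pi_1:\mathbb R^d\to\mathbb R$ be defined by $\pi_1(x\mathbf v_1+\mathbf y)=x$ for $x\in\mathbb R$, $\mathbf y\in H$, and put $\Psi(x)=\sum_{j=1}^d\Gamma_j(x)\mathbf v_j$ for $x\in\mathbb Q(\beta)$ and $$\psi(u)=\sum_{k\ge1}u_k\beta^{-k}\,\mathbf v_1-\sum_{k\le0}\sum_{j=2}^d\Gamma_j(u_k)\beta_j^{-k}\,\mathbf v_j\in\mathbb R^d\qquad(u\in A^{\mathbb Z}).$$ Let $\widehat X=\psi(\mathcal S)$ and $\widehat X_a=\psi(\{u\in\mathcal S:u_1=a\})$ for $a\in A$, and let $\pi$ be the restriction of $\pi_1$ to $\widehat X$. Let $\lambda^d$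 be $d$-dimensional Lebesgue measure, $\mathcal B$ and $\widehat{\mathcal B}$ the $\sigma$-algebras of Lebesgue measurable subsets of $X$ and $\widehat X$, and $\mu=\lambda^d\circ\pi^{-1}$. **Theorem.** The sets $\widehat X_a$, $a\in A$, are pairwise disjoint with union $\widehat X$, so that $\widehat T\mathbf x=M_\beta\mathbf x-\Psi(a)$ for $\mathbf x\in\widehat X_a$ defines a map on $\widehat X$, and $(\widehat X,\widehat{\mathcal B},\lambda^d,\widehat T)$ is a natural extension of $(X,\mathcal B,\mu,T)$. Explicitly: * $\widehat X$ is Lebesgue measurable with $0<\lambda^d(\widehat X)<\infty$, $\widehat T$ maps $\widehat X$ to itself and is measurable and preserves $\lambda^d$; likewise $0<\mu(X)<\infty$, and $T$ is measurable and preserves $\mu$. * There are sets $\widehat N\in\widehat{\mathcal B}$ and $M\in\mathcal B$ with $\lambda^d(\widehat N)=\mu(M)=0$ such that $\widehat T(\widehat X\setminus\widehat N)\subseteq\widehat X\setminus\widehat N$ and $T(X\setminus M)\subseteq X\setminus M$; the map $\pi:\widehat X\setminus\widehat N\to X\setminus M$ is surjective, measurable and measure preserving; $\pi(\widehat T\mathbf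 x)=T\pi(\mathbf x)$ for all $\mathbf x\in\widehat X\setminus\widehat N$; $\widehat T:\widehat X\setminus\widehat N\to\widehat X\setminus\widehat N$ is a bijection with measurable inverse; and $\bigvee_{k\ge0}\widehat T^k\pi^{-1}\mathcal B=\widehat{\mathcal B}$ up to $\lambda^d$-null sets, where the left-hand side is the $\sigma$-algebra generated by the sets $\widehat T^k\big(\pi^{-1}(B)\setminus\widehat N\big)$, $k\ge0$, $B\in\mathcal B$: a set $C\subseteq\widehat X$ is Lebesgue measurable if and only if it differs by a $\lambda^d$-null set from an element of this $\sigma$-algebra. -/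

import Mathlib

open MeasureTheory Set
open scoped ENNReal symmDiff Matrix

noncomputable section

namespace BetaNatExt

/-! ### Natural extensions of measure preserving systems -/

/-- `(Y, 𝓑, ν, S)` is a measure preserving dynamical system of positive finite total measure, where
`Y` is a measurable subset of an ambient measurable space, `𝓑` consists of the measurable subsets
of `Y`, and only the values of `S` on `Y` matter. -/
structure IsSystem {E : Type*} [MeasurableSpace E] (Y : Set E) (ν : Measure E) (S : E → E) :
    Prop where
  measurableSet_carrier : MeasurableSet Y
  measure_pos : 0 < ν Y
  measure_lt_top : ν Y < ∞
  mapsTo : MapsTo S Y Y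
  measurable : ∀ B ⊆ Y, MeasurableSet B → MeasurableSet (Y ∩ S ⁻¹' B)
  measurePreserving : ∀ B ⊆ Y, MeasurableSet B → ν (Y ∩ S ⁻¹' B) = ν B

/-- The `σ`-algebra `⋁_{k ≥ 0} S^k π⁻¹ 𝓑`, where `𝓑` is the `σ`-algebra of measurable subsets of
`X`, `π` is regarded as a map on `Y'` and `S` as a bijection of `Y'`. -/
@[reducible] def joinSigma {E F : Type*} [MeasurableSpace F] (Y' : Set E) (S : E → E) (X : Set F)
    (π : E → F) : MeasurableSpace E :=
  MeasurableSpace.generateFrom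
    {G | ∃ k : ℕ, ∃ B ⊆ X, MeasurableSet B ∧ G = S^[k] '' (Y' ∩ π ⁻¹' B)}

/-- `(Y, ν, S)` is, via the map `π`, a natural extension of `(X, μ, T)`: both are measure preserving
systems, and after removing null sets `N ⊆ Y` and `M ⊆ X`, the map `π` is a factor map, `S` is
invertible, and `⋁_{k ≥ 0} S^k π⁻¹ 𝓑` is the whole `σ`-algebra of `Y` (as always for
measure-theoretic joins: up to null sets). -/
structure IsNaturalExtension {E F : Type*} [MeasurableSpace E] [MeasurableSpace F]
    (Y : Set E) (ν : Measure E) (S : E → E) (X : Set F) (μ : Measure F) (T : F → F)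
    (π : E → F) : Prop where
  system : IsSystem Y ν S
  system_base : IsSystem X μ T
  exists_null : ∃ N ⊆ Y, ∃ M ⊆ X, MeasurableSet N ∧ MeasurableSet M ∧
    -- the removed sets are null, their complements are forward invariant
    ν N = 0 ∧ μ M = 0 ∧ MapsTo S (Y \ N) (Y \ N) ∧ MapsTo T (X \ M) (X \ M) ∧
    -- `π : Y \ N → X \ M` is surjective, measurable and measure preserving
    π '' (Y \ N) = X \ M ∧
    (∀ B ⊆ X \ M, MeasurableSet B →
      MeasurableSet ((Y \ N) ∩ π ⁻¹' B) ∧ ν ((Y \ N) ∩ π ⁻¹' B) = μ B) ∧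
    -- `π` intertwines `S` and `T`
    (∀ y ∈ Y \ N, π (S y) = T (π y)) ∧
    -- `S : Y \ N → Y \ N` is a bijection with measurable inverse
    BijOn S (Y \ N) (Y \ N) ∧
    (∀ C ⊆ Y \ N, MeasurableSet C → MeasurableSet (S '' C)) ∧
    -- the images of `π⁻¹ 𝓑` under the iterates of `S` generate, up to null sets
    (∀ C ⊆ Y, MeasurableSet C ↔
      ∃ G, MeasurableSet[joinSigma (Y \ N) S X π] G ∧ ν (C ∆ (Y ∩ G)) = 0)

/-! ### Right-continuous `β`-transformations -/

/-- A right-continuous `β`-transformation: a non-empty finite set `A` of real digits and pairwise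
disjoint non-empty sets `X_a`, `a ∈ A`, each a finite union of intervals `[ℓ, r)`, such that the
union of the sets `β X_a - a` is `X = ⋃ X_a`. The values of `piece` outside of `A` are
irrelevant. -/
structure RightContBetaTransformation (β : ℝ) where
  A : Finset ℝ
  piece : ℝ → Set ℝ
  A_nonempty : A.Nonempty
  piece_nonempty : ∀ a ∈ A, (piece a).Nonempty
  piece_eq : ∀ a ∈ A, ∃ I : Finset (ℝ × ℝ), piece a = ⋃ p ∈ I, Ico p.1 p.2
  pairwiseDisjoint : (A : Set ℝ).PairwiseDisjoint piece
  image_eq : (⋃ a ∈ A, (fun x => β * x - a) '' piece a) = ⋃ a ∈ A, piece a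

namespace RightContBetaTransformation

variable {β : ℝ} (T : RightContBetaTransformation β)

/-- The domain `X`. -/
def X : Set ℝ := ⋃ a ∈ T.A, T.piece a

open Classical in
/-- The digit of `x ∈ X`, i.e. the unique `a ∈ A` with `x ∈ X_a` (and `0` outside of `X`). -/
def digit (x : ℝ) : ℝ := if h : ∃ a ∈ T.A, x ∈ T.piece a then h.choose else 0

/-- The transformation `T x = β x - a` for `x ∈ X_a`. -/
def map (x : ℝ) : ℝ := β * x - T.digit x

/-- The `T`-expansion `b_1(x) b_2(x) ⋯` of `x`; here `T.expansion x n` is `b_{n+1}(x)`. -/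
def expansion (x : ℝ) (n : ℕ) : ℝ := T.digit (T.map^[n] x)

/-- A right-infinite sequence is `T`-admissible if it is the expansion of a point of `X`. -/
def Admissible (u : ℕ → ℝ) : Prop := ∃ x ∈ T.X, u = T.expansion x

/-- The set `𝒮` of two-sided sequences all of whose right-infinite tails are `T`-admissible. -/
def twoSided : Set (ℤ → ℝ) := {u | ∀ k : ℤ, T.Admissible fun n : ℕ => u (k + n)}

end RightContBetaTransformation

/-! ### Pisot units, conjugates and eigenvectors of the companion matrix -/

/-- `β` is a Pisot unit: a real algebraic integer `> 1` all of whose other Galois conjugates have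
modulus `< 1` and whose minimal polynomial has constant term `± 1`. -/
structure IsPisotUnit (β : ℝ) : Prop where
  isIntegral : IsIntegral ℤ β
  one_lt : 1 < β
  norm_lt_one : ∀ z : ℂ, Polynomial.aeval z (minpoly ℤ β) = 0 → z ≠ (β : ℂ) → ‖z‖ < 1
  abs_coeff_zero : |(minpoly ℤ β).coeff 0| = 1

/-- The field `ℚ(β)`. -/
abbrev QBeta (β : ℝ) : IntermediateField ℚ ℝ := IntermediateField.adjoin ℚ {β}

/-- The field embeddings `Γ_j : ℚ(β) → ℂ`. They serve as indices `j`, being in bijection with the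
Galois conjugates `β_j = Γ_j(β)`. -/
abbrev Emb (β : ℝ) : Type := QBeta β →ₐ[ℚ] ℂ

/-- The embedding `Γ_1`, i.e. the inclusion `ℚ(β) ⊆ ℝ ⊆ ℂ`. -/
def emb₁ (β : ℝ) : Emb β := (IsScalarTower.toAlgHom ℚ ℝ ℂ).comp (QBeta β).val

/-- The Galois conjugate `β_j = Γ_j(β)`. -/
def conj (β : ℝ) (j : Emb β) : ℂ := j (IntermediateField.AdjoinSimple.gen ℚ β)

open Classical in
/-- `Γ_j(x)` for a real number `x ∈ ℚ(β)` (and `0` for other `x`). -/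
def Gam (β : ℝ) (j : Emb β) (x : ℝ) : ℂ := if h : x ∈ QBeta β then j ⟨x, h⟩ else 0

/-- The degree `d` of `β`. -/
def deg (β : ℝ) : ℕ := (minpoly ℤ β).natDegree

/-- The companion matrix `M_β`: with the minimal polynomial `x^d - c_1 x^{d-1} - ⋯ - c_d`, the first
row is `(c_1, …, c_d)`, and there are ones below the diagonal. -/
def companion (β : ℝ) : Matrix (Fin (deg β)) (Fin (deg β)) ℝ := fun i k =>
  if (i : ℕ) = 0 then -((minpoly ℤ β).coeff (deg β - 1 - k) : ℝ)
  else if (i : ℕ) = k + 1 then 1 else 0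

/-- The eigenvector `v_j = ν_j (β_j^{d-1}, …, β_j, 1)ᵗ` of `M_β`, where
`ν_j = ∏_{i ≠ j} (β_j - β_i)⁻¹`. These are the unique multiples with
`v_1 + ⋯ + v_d = (1, 0, …, 0)ᵗ`. -/
def eigvec (β : ℝ) (j : Emb β) : Fin (deg β) → ℂ := fun i =>
  (∏ᶠ (l : Emb β) (_ : l ≠ j), (conj β j - conj β l))⁻¹ * conj β j ^ (deg β - 1 - (i : ℕ))

/-- The real eigenvector `v_1`. -/
def v₁ (β : ℝ) : Fin (deg β) → ℝ := fun i => (eigvec β (emb₁ β) i).re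

/-- The subspace `H` of `ℝ^d` spanned by the real and imaginary parts of `v_2, …, v_d`. -/
def H (β : ℝ) : Submodule ℝ (Fin (deg β) → ℝ) :=
  Submodule.span ℝ {y | ∃ j : Emb β, j ≠ emb₁ β ∧
    (y = (fun i => (eigvec β j i).re) ∨ y = (fun i => (eigvec β j i).im))}

open Classical in
/-- The projection `π_1 : ℝ^d → ℝ` along `H`: `π_1(x) = t` if `x = t v_1 + y` with `y ∈ H`. -/
def proj (β : ℝ) (x : Fin (deg β) → ℝ) : ℝ :=
  if h : ∃ t : ℝ, x - t • v₁ β ∈ H β then h.choose else 0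

/-- `Ψ(x) = ∑_j Γ_j(x) v_j`; the sum is a real vector since the non-real terms come in complex
conjugate pairs. -/
def Psi (β : ℝ) (x : ℝ) : Fin (deg β) → ℝ := fun i =>
  (∑ᶠ j : Emb β, Gam β j x * eigvec β j i).re

/-- `ψ(u) = ∑_{k ≥ 1} u_k β^{-k} v_1 - ∑_{k ≤ 0} ∑_{j ≥ 2} Γ_j(u_k) β_j^{-k} v_j`; the second sum is
over `k = -n`, and its inner sums are real vectors. -/
def psi (β : ℝ) (u : ℤ → ℝ) : Fin (deg β) → ℝ := fun i =>
  (∑' n : ℕ, u (n + 1) / β ^ (n + 1)) * v₁ β i -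
    ∑' n : ℕ, (∑ᶠ (j : Emb β) (_ : j ≠ emb₁ β),
      Gam β j (u (-(n : ℤ))) * conj β j ^ n * eigvec β j i).re

/-! ### The natural extension domain -/

namespace RightContBetaTransformation

variable {β : ℝ} (T : RightContBetaTransformation β)

/-- `X̂ = ψ(𝒮)`. -/
def Xhat : Set (Fin (deg β) → ℝ) := psi β '' T.twoSided

/-- `X̂_a = ψ({u ∈ 𝒮 : u_1 = a})`. -/
def XhatPiece (a : ℝ) : Set (Fin (deg β) → ℝ) := psi β '' {u | u ∈ T.twoSided ∧ u 1 = a}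

open Classical in
/-- The digit `a ∈ A` with `x ∈ X̂_a`, for `x ∈ X̂` (and `0` outside of `X̂`). -/
def hatDigit (x : Fin (deg β) → ℝ) : ℝ :=
  if h : ∃ a ∈ T.A, x ∈ T.XhatPiece a then h.choose else 0

/-- `T̂ x = M_β x - Ψ(a)` for `x ∈ X̂_a`. -/
def That (x : Fin (deg β) → ℝ) : Fin (deg β) → ℝ := companion β *ᵥ x - Psi β (T.hatDigit x)

end RightContBetaTransformation

/-- `ℝ^d` with the Lebesgue `σ`-algebra. -/
abbrev LebSpace (d : ℕ) : Type := NullMeasurableSpace (Fin d → ℝ) volume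

/-- `ℝ` with the Lebesgue `σ`-algebra. -/
abbrev LebLine : Type := NullMeasurableSpace ℝ volume

/-- Lebesgue measure `λ^d` on the Lebesgue `σ`-algebra of `ℝ^d`. -/
def leb (d : ℕ) : Measure (LebSpace d) := (volume : Measure (Fin d → ℝ)).completion

/-- The measure `μ = λ^d ∘ π⁻¹` on the Lebesgue `σ`-algebra, with `π` the restriction of `π_1` to
`X̂`. -/
def RightContBetaTransformation.mu {β : ℝ} (T : RightContBetaTransformation β) :
    Measure LebLine :=
  Measure.map (α := LebSpace (deg β)) (β := LebLine) (proj β) ((leb (deg β)).restrict T.Xhat)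

/-! ### The eigenvectors are the ones described -/

theorem finite_emb {β : ℝ} (h : IsIntegral ℤ β) : Finite (Emb β) := by
  have : IsIntegral ℚ β := h.tower_top
  have : FiniteDimensional ℚ (QBeta β) := IntermediateField.adjoin.finiteDimensional this
  infer_instance

theorem conj_injective (β : ℝ) : Function.Injective (conj β) := by
  intro j l h
  apply IntermediateField.adjoin_algHom_ext ℚ
  rintro x hx
  obtain rfl := Set.mem_singleton_iff.mp hx
  exact h

theorem card_emb {β : ℝ} (h : IsIntegral ℤ β) : Nat.card (Emb β) = deg β := by
  have hq : IsIntegral ℚ β := h.tower_top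
  have : FiniteDimensional ℚ (QBeta β) := IntermediateField.adjoin.finiteDimensional hq
  rw [Nat.card_eq_fintype_card, AlgHom.card, IntermediateField.adjoin.finrank hq,
    minpoly.isIntegrallyClosed_eq_field_fractions' ℚ h,
    (minpoly.monic h).natDegree_map, deg]

theorem aeval_conj {β : ℝ} (j : Emb β) :
    Polynomial.aeval (conj β j) (minpoly ℤ β) = 0 := by
  have h1 : Polynomial.aeval (IntermediateField.AdjoinSimple.gen ℚ β) (minpoly ℤ β) = 0 := by
    apply (QBeta β).val.injective
    rw [map_zero]
    have := Polynomial.aeval_algHom_apply ((QBeta β).val.restrictScalars ℤ)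
      (IntermediateField.AdjoinSimple.gen ℚ β) (minpoly ℤ β)
    exact this.symm.trans (minpoly.aeval ℤ β)
  have := Polynomial.aeval_algHom_apply (j.restrictScalars ℤ)
      (IntermediateField.AdjoinSimple.gen ℚ β) (minpoly ℤ β)
  rw [h1, map_zero] at this
  exact this

/-- `v_1 + ⋯ + v_d = (1, 0, …, 0)ᵗ`. -/
theorem finsum_eigvec {β : ℝ} (h : IsIntegral ℤ β) (i : Fin (deg β)) :
    ∑ᶠ j : Emb β, eigvec β j i = if (i : ℕ) = 0 then 1 else 0 := by
  classical
  have := finite_emb h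
  have := Fintype.ofFinite (Emb β)
  have hc : (Finset.univ : Finset (Emb β)).card = deg β := by
    rw [← card_emb h, Nat.card_eq_fintype_card, Finset.card_univ]
  have hi := i.2
  have key := Lagrange.coeff_eq_sum (s := (Finset.univ : Finset (Emb β))) (v := conj β)
    (conj_injective β).injOn (P := Polynomial.X ^ (deg β - 1 - (i : ℕ)))
    (by rw [Polynomial.degree_X_pow, hc]; exact_mod_cast (by omega))
  rw [finsum_eq_sum_of_fintype]
  rw [hc, Polynomial.coeff_X_pow] at key
  have e : (deg β - 1 = deg β - 1 - (i : ℕ)) ↔ (i : ℕ) = 0 := by omega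
  simp only [e] at key
  rw [key]
  refine Finset.sum_congr rfl fun j _ => ?_
  have : ∏ᶠ (l : Emb β) (_ : l ≠ j), (conj β j - conj β l) =
      ∏ l ∈ Finset.univ.erase j, (conj β j - conj β l) := by
    rw [← finprod_mem_coe_finset]
    simp
  rw [eigvec, this]
  simp [div_eq_mul_inv, mul_comm]

/-- `M_β v_j = β_j v_j`. -/
theorem companion_mulVec_eigvec {β : ℝ} (h : IsIntegral ℤ β) (j : Emb β) :
    (companion β).map (algebraMap ℝ ℂ) *ᵥ eigvec β j = conj β j • eigvec β j := by
  set z := conj β j with hz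
  have hroot := aeval_conj j
  rw [Polynomial.aeval_eq_sum_range, Finset.sum_range_succ] at hroot
  have hlead : (minpoly ℤ β).coeff (minpoly ℤ β).natDegree = 1 := (minpoly.monic h).coeff_natDegree
  rw [hlead, one_smul, ← Finset.sum_range_reflect, Finset.sum_range] at hroot
  ext i
  simp only [Matrix.mulVec, dotProduct, Matrix.map_apply, companion, Pi.smul_apply, smul_eq_mul,
    eigvec]
  set c := (∏ᶠ (l : Emb β) (_ : l ≠ j), (conj β j - conj β l))⁻¹
  rw [← hz] at *
  by_cases hi : (i : ℕ) = 0
  · simp only [hi, if_true]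
    have hd : 0 < deg β := i.pos
    have h2 : z * (c * z ^ (deg β - 1 - 0)) = c * z ^ deg β := by
      obtain ⟨m, hm⟩ : ∃ m, deg β = m + 1 := ⟨deg β - 1, by omega⟩
      rw [hm]; simp only [Nat.add_sub_cancel, Nat.sub_zero]; ring
    rw [h2, ← sub_eq_zero, ← neg_eq_zero]
    have h3 := congrArg (c * ·) hroot
    simp only [mul_zero, mul_add, Finset.mul_sum] at h3
    rw [neg_sub, sub_eq_add_neg, ← Finset.sum_neg_distrib, add_comm]
    refine Eq.trans ?_ h3
    congr 1
    refine Finset.sum_congr rfl fun k _ => ?_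
    simp [deg]; ring
  · obtain ⟨m, hm⟩ : ∃ m, (i : ℕ) = m + 1 := ⟨i - 1, by omega⟩
    have hi2 := i.2
    rw [Finset.sum_eq_single ⟨m, by omega⟩]
    · simp only [hm]
      have : deg β - 1 - m = (deg β - 1 - (m + 1)) + 1 := by omega
      rw [this]; simp; ring
    · intro b _ hb
      have : ¬ (i : ℕ) = b + 1 := fun hh => hb (Fin.ext (by simp; omega))
      simp [hi, this]
    · simp

end BetaNatExt

end

open MeasureTheory Set
open scoped ENNReal symmDiff Matrix

noncomputable section

namespace BetaNatExt

variable {β : ℝ}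

/-! ### Complex conjugation and coordinates with respect to the eigenvectors -/

/-! In the coordinates given by the eigenvectors, `companion β` multiplies the `j`-th coordinate by
`β_j`: it expands along `v_1` and contracts `H`. The map `lift`, which sends `x` to `M_β x - Ψ(a)`
when `π_1(x) ∈ X_a`, therefore lies over `T` and contracts all other coordinates, so a bounded set
`trap R` over `X` is forward invariant. The series `ψ(u)` is what solving the contracting recursion
along a backward orbit gives. Hence `X̂` is the set of points with an infinite backward orbit in the
trap, and since fibers are finite this is `⋂ n, lift^n (trap R)` (`mem_Xhat_iff`, `Xhat_eq_iInter`).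
So `X̂` is Borel, bounded and mapped onto itself.

Positive measure (`exists_lattice_add_mem_Xhat`): the vectors `Ψ(a)` lie in a lattice `L = q⁻¹ ℤ^d`,
which `M_β` preserves because its determinant is `±1`, so `lift^n z` and `M_β^n z` agree modulo `L`.
Consequently every coset `p + L` meets every `lift^n (trap R)`; it has finitely many points in the
trap, so one of them lies in `X̂`. Countably many translates of `X̂` thus cover the space.

Invariance: each branch preserves volume and `T̂` is onto, so `λ(B) ≤ λ(T̂⁻¹B)` for `B` and for its
complement; finiteness of the measure forces equality. A set covered by two branches has a preimage
of at least twice its volume, so it is null. Thus `T̂` is a bijection off the grand orbit of a null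
set.

Generation: if `k` digits and a fine approximation of `T^k x` are fixed, the `T̂^k`-image of the
corresponding cylinder has small diameter. Open sets are therefore countable unions of such images.
-/

theorem deg_pos (h : IsIntegral ℤ β) : 0 < deg β := minpoly.natDegree_pos h

/-- The embedding `x ↦ conj (Γ_j x)`. -/
def conjEmb (j : Emb β) : Emb β :=
  ((Complex.conjAe.restrictScalars ℚ : ℂ ≃ₐ[ℚ] ℂ) : ℂ →ₐ[ℚ] ℂ).comp j

theorem conjEmb_apply (j : Emb β) (x : QBeta β) : conjEmb j x = star (j x) := rfl

theorem conj_conjEmb (j : Emb β) : conj β (conjEmb j) = star (conj β j) := rfl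

@[simp]
theorem conjEmb_conjEmb (j : Emb β) : conjEmb (conjEmb j) = j := by
  ext x
  simp [conjEmb_apply]

@[simp]
theorem conjEmb_emb₁ : conjEmb (emb₁ β) = emb₁ β := by
  ext x
  rw [conjEmb_apply]
  exact Complex.conj_ofReal _

theorem conj_emb₁ : conj β (emb₁ β) = β := rfl

theorem conjEmb_ne_emb₁ {j : Emb β} : conjEmb j ≠ emb₁ β ↔ j ≠ emb₁ β := by
  refine not_congr ⟨fun h => ?_, fun h => ?_⟩
  · rw [← conjEmb_conjEmb j, h, conjEmb_emb₁]
  · rw [h, conjEmb_emb₁]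

/-- Complex conjugation as a permutation of the embeddings. -/
def conjEquiv : Equiv.Perm (Emb β) := ⟨conjEmb, conjEmb, conjEmb_conjEmb, conjEmb_conjEmb⟩

theorem Gam_of_mem {a : ℝ} (ha : a ∈ QBeta β) (j : Emb β) : Gam β j a = j ⟨a, ha⟩ := by
  simp [Gam, ha]

theorem Gam_conjEmb (j : Emb β) (a : ℝ) : Gam β (conjEmb j) a = star (Gam β j a) := by
  by_cases ha : a ∈ QBeta β
  · rw [Gam_of_mem ha, Gam_of_mem ha, conjEmb_apply]
  · simp [Gam, ha]

theorem Gam_emb₁ {a : ℝ} (ha : a ∈ QBeta β) : Gam β (emb₁ β) a = a := by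
  rw [Gam_of_mem ha]; rfl

theorem eigvec_eq_prod [Fintype (Emb β)] [DecidableEq (Emb β)] (j : Emb β) (i : Fin (deg β)) :
    eigvec β j i = (∏ l ∈ Finset.univ.erase j, (conj β j - conj β l))⁻¹ *
      conj β j ^ (deg β - 1 - (i : ℕ)) := by
  have : ∏ᶠ (l : Emb β) (_ : l ≠ j), (conj β j - conj β l) =
      ∏ l ∈ Finset.univ.erase j, (conj β j - conj β l) := by
    rw [← finprod_mem_coe_finset]
    simp
  rw [eigvec, this]

/-- Complex conjugation permutes the embeddings, hence the factors of the product defining the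
normalizing constant. -/
theorem eigvec_conjEmb (h : IsIntegral ℤ β) (j : Emb β) (i : Fin (deg β)) :
    eigvec β (conjEmb j) i = star (eigvec β j i) := by
  classical
  have := finite_emb h
  have := Fintype.ofFinite (Emb β)
  have hp : ∏ l ∈ Finset.univ.erase (conjEmb j), (star (conj β j) - conj β l) =
      star (∏ l ∈ Finset.univ.erase j, (conj β j - conj β l)) := by
    rw [show ∀ z : ℂ, star z = starRingEnd ℂ z from fun _ => rfl,
      show ∀ z : ℂ, star z = starRingEnd ℂ z from fun _ => rfl, map_prod]
    refine Finset.prod_equiv conjEquiv (fun l => ?_) (fun l _ => ?_)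
    · simp only [Finset.mem_erase, Finset.mem_univ, and_true, conjEquiv, Equiv.coe_fn_mk]
      refine not_congr ⟨fun e => by rw [e, conjEmb_conjEmb], fun e => by rw [← e, conjEmb_conjEmb]⟩
    · simp [conjEquiv, conj_conjEmb]
  rw [eigvec_eq_prod (β := β), eigvec_eq_prod (β := β), conj_conjEmb, hp]
  simp

theorem eigvec_ne_zero (h : IsIntegral ℤ β) (j : Emb β) : eigvec β j ≠ 0 := by
  classical
  have := finite_emb h
  have := Fintype.ofFinite (Emb β)
  intro h0
  have h1 := congrFun h0 ⟨deg β - 1, by have := deg_pos h; omega⟩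
  rw [eigvec_eq_prod (β := β)] at h1
  simp only [tsub_self, pow_zero, mul_one, Pi.zero_apply, inv_eq_zero,
    Finset.prod_eq_zero_iff] at h1
  obtain ⟨l, hl, hl'⟩ := h1
  exact (Finset.mem_erase.1 hl).1 (conj_injective β (sub_eq_zero.1 hl')).symm

theorem linearIndependent_eigvec (h : IsIntegral ℤ β) : LinearIndependent ℂ (eigvec β) := by
  refine Module.End.eigenvectors_linearIndependent'
    (Matrix.toLin' ((companion β).map (algebraMap ℝ ℂ))) (conj β) (conj_injective β) _ fun j => ?_
  rw [Module.End.hasEigenvector_iff, Module.End.mem_eigenspace_iff]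
  exact ⟨companion_mulVec_eigvec h j, eigvec_ne_zero h j⟩

/-- The basis of `ℂ^d` consisting of the eigenvectors. -/
def eigBasis (h : IsIntegral ℤ β) : Module.Basis (Emb β) ℂ (Fin (deg β) → ℂ) :=
  letI := finite_emb h
  letI := Fintype.ofFinite (Emb β)
  letI : Nonempty (Emb β) := ⟨emb₁ β⟩
  basisOfLinearIndependentOfCardEqFinrank (linearIndependent_eigvec h) (by
    rw [Module.finrank_fin_fun, ← card_emb h, Nat.card_eq_fintype_card])

theorem eigBasis_apply (h : IsIntegral ℤ β) (j : Emb β) : eigBasis h j = eigvec β j := by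
  simp [eigBasis]

/-- The coordinate of a real vector with respect to the eigenvector `v_j`. -/
def coord (h : IsIntegral ℤ β) (j : Emb β) : (Fin (deg β) → ℝ) →ₗ[ℝ] ℂ :=
  ((eigBasis h).coord j).restrictScalars ℝ ∘ₗ
    (Complex.ofRealCLM : ℝ →ₗ[ℝ] ℂ).compLeft (Fin (deg β))

theorem coord_apply (h : IsIntegral ℤ β) (j : Emb β) (x : Fin (deg β) → ℝ) :
    coord h j x = (eigBasis h).repr (fun i => (x i : ℂ)) j := rfl

theorem sum_coord [Fintype (Emb β)] (h : IsIntegral ℤ β) (x : Fin (deg β) → ℝ)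
    (i : Fin (deg β)) : ∑ j, coord h j x * eigvec β j i = x i := by
  have := congrFun ((eigBasis h).sum_repr (fun i => (x i : ℂ))) i
  rw [← this, Finset.sum_apply]
  simp [coord_apply, eigBasis_apply]

theorem coord_ext (h : IsIntegral ℤ β) {x y : Fin (deg β) → ℝ}
    (hxy : ∀ j, coord h j x = coord h j y) : x = y := by
  have := finite_emb h
  have := Fintype.ofFinite (Emb β)
  ext i
  have := sum_coord h x i
  simp only [hxy, sum_coord h y i] at this
  exact_mod_cast this.symm

theorem coord_eq_of_sum [Fintype (Emb β)] (h : IsIntegral ℤ β) {x : Fin (deg β) → ℝ}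
    {f : Emb β → ℂ} (hf : ∀ i, ∑ j, f j * eigvec β j i = x i) (j : Emb β) : coord h j x = f j := by
  classical
  have : (fun i => (x i : ℂ)) = ∑ j, f j • eigBasis h j := by
    ext i
    rw [Finset.sum_apply, ← hf]
    simp [eigBasis_apply]
  rw [coord_apply, this, Module.Basis.repr_sum_self]

theorem coord_conjEmb (h : IsIntegral ℤ β) (j : Emb β) (x : Fin (deg β) → ℝ) :
    coord h (conjEmb j) x = star (coord h j x) := by
  have := finite_emb h
  have := Fintype.ofFinite (Emb β)
  have := coord_eq_of_sum h (x := x) (f := fun j => star (coord h (conjEmb j) x)) (fun i => ?_)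
    (conjEmb j)
  · rw [this, conjEmb_conjEmb]
  · have h1 := congrArg star (sum_coord h x i)
    rw [star_sum] at h1
    refine Eq.trans ?_ (h1.trans (by simp))
    refine Finset.sum_equiv conjEquiv (by simp) (fun l _ => ?_)
    simp [conjEquiv, eigvec_conjEmb h]

/-- Coefficients compatible with conjugation give a sum that is already real. The real parts in the
definitions of `Psi` and `psi` thus lose nothing. -/
theorem coord_eq_of_re_sum [Fintype (Emb β)] (h : IsIntegral ℤ β) {x : Fin (deg β) → ℝ}
    {f : Emb β → ℂ} (hc : ∀ j, f (conjEmb j) = star (f j))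
    (hf : ∀ i, x i = (∑ j, f j * eigvec β j i).re) (j : Emb β) : coord h j x = f j := by
  refine coord_eq_of_sum h (fun i => ?_) j
  rw [hf]
  refine (Complex.conj_eq_iff_re.1 ?_).symm
  rw [map_sum]
  refine Finset.sum_equiv conjEquiv (by simp) (fun l _ => ?_)
  simp [conjEquiv, eigvec_conjEmb h, hc]

theorem coord_mulVec (h : IsIntegral ℤ β) (j : Emb β) (x : Fin (deg β) → ℝ) :
    coord h j (companion β *ᵥ x) = conj β j * coord h j x := by
  have := finite_emb h
  have := Fintype.ofFinite (Emb β)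
  refine coord_eq_of_sum h (f := fun j => conj β j * coord h j x) (fun i => ?_) j
  have h1 : ((companion β *ᵥ x) i : ℂ) =
      ((companion β).map (algebraMap ℝ ℂ) *ᵥ fun i => (x i : ℂ)) i := by
    simp [Matrix.mulVec, dotProduct]
  have h2 : (fun i => (x i : ℂ)) = ∑ j, coord h j x • eigvec β j := by
    ext i
    rw [← sum_coord h x i, Finset.sum_apply]
    rfl
  rw [h1, h2, Matrix.mulVec_sum, Finset.sum_apply]
  refine Finset.sum_congr rfl fun l _ => ?_
  rw [Matrix.mulVec_smul, companion_mulVec_eigvec h]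
  simp only [Pi.smul_apply, smul_eq_mul]
  ring

theorem coord_v₁ (h : IsIntegral ℤ β) (j : Emb β) [Decidable (j = emb₁ β)] :
    coord h j (v₁ β) = if j = emb₁ β then 1 else 0 := by
  classical
  have := finite_emb h
  have := Fintype.ofFinite (Emb β)
  rw [coord_eq_of_re_sum h (f := fun j => if j = emb₁ β then 1 else 0) (fun j => ?_) (fun i => ?_)]
  · congr
  · by_cases hj : j = emb₁ β
    · simp [hj]
    · simp [hj, conjEmb_ne_emb₁.2 hj]
  · simp [v₁]

theorem coord_emb₁_eq_zero (h : IsIntegral ℤ β) {x : Fin (deg β) → ℝ} (hx : x ∈ H β) :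
    coord h (emb₁ β) x = 0 := by
  classical
  have := finite_emb h
  have := Fintype.ofFinite (Emb β)
  suffices H β ≤ LinearMap.ker (coord h (emb₁ β)) from this hx
  refine Submodule.span_le.2 ?_
  rintro y ⟨j, hj, hy⟩
  rw [SetLike.mem_coe, LinearMap.mem_ker]
  have hj' := conjEmb_ne_emb₁.2 hj
  rcases hy with rfl | rfl
  -- `Re v = (v + v̄)/2`. If `j` is a real embedding, both terms sit at the same index and add up.
  · rw [coord_eq_of_sum h (f := fun l => (if l = j then 1 / 2 else 0) +
      if l = conjEmb j then 1 / 2 else 0)]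
    · simp [hj.symm, hj'.symm]
    · intro i
      simp only [add_mul, Finset.sum_add_distrib, ite_mul, zero_mul, Finset.sum_ite_eq',
        Finset.mem_univ, if_true, eigvec_conjEmb h]
      apply Complex.ext <;> simp; ring
  -- `Im v = (v - v̄)/(2i)`, that is, coefficients `-i/2` at `v` and `i/2` at `v̄`.
  · rw [coord_eq_of_sum h (f := fun l => (if l = j then -Complex.I / 2 else 0) +
      if l = conjEmb j then Complex.I / 2 else 0)]
    · simp [hj.symm, hj'.symm]
    · intro i
      simp only [add_mul, Finset.sum_add_distrib, ite_mul, zero_mul, Finset.sum_ite_eq',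
        Finset.mem_univ, if_true, eigvec_conjEmb h]
      apply Complex.ext <;> simp <;> ring

theorem coord_emb₁_re (h : IsIntegral ℤ β) (x : Fin (deg β) → ℝ) :
    ((coord h (emb₁ β) x).re : ℂ) = coord h (emb₁ β) x := by
  have := coord_conjEmb h (emb₁ β) x
  rw [conjEmb_emb₁] at this
  exact Complex.conj_eq_iff_re.1 this.symm

theorem sub_smul_v₁_mem_H (h : IsIntegral ℤ β) (x : Fin (deg β) → ℝ) :
    x - (coord h (emb₁ β) x).re • v₁ β ∈ H β := by
  classical
  have := finite_emb h
  have := Fintype.ofFinite (Emb β)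
  have : x - (coord h (emb₁ β) x).re • v₁ β = ∑ j ∈ Finset.univ.erase (emb₁ β),
      ((coord h j x).re • (fun i => (eigvec β j i).re) -
        (coord h j x).im • (fun i => (eigvec β j i).im)) := by
    rw [sub_eq_iff_eq_add]
    ext i
    have h1 := congrArg Complex.re (sum_coord h x i)
    rw [Complex.ofReal_re, ← Finset.add_sum_erase _ _ (Finset.mem_univ (emb₁ β)),
      ← coord_emb₁_re h x, Complex.add_re, Complex.re_ofReal_mul, Complex.re_sum] at h1
    rw [← h1, Pi.add_apply, Finset.sum_apply, add_comm]
    simp [v₁]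
  rw [this]
  refine Submodule.sum_mem _ fun j hj => Submodule.sub_mem _ (Submodule.smul_mem _ _ ?_)
    (Submodule.smul_mem _ _ ?_)
  · exact Submodule.subset_span ⟨j, (Finset.mem_erase.1 hj).1, Or.inl rfl⟩
  · exact Submodule.subset_span ⟨j, (Finset.mem_erase.1 hj).1, Or.inr rfl⟩

/-- The first coordinate vanishes on `H` and is `1` on `v_1`, so the chosen scalar in `proj` is
forced. -/
theorem proj_eq_re (h : IsIntegral ℤ β) (x : Fin (deg β) → ℝ) :
    proj β x = (coord h (emb₁ β) x).re := by
  classical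
  have hex : ∃ t : ℝ, x - t • v₁ β ∈ H β := ⟨_, sub_smul_v₁_mem_H h x⟩
  have h1 := coord_emb₁_eq_zero h hex.choose_spec
  rw [map_sub, map_smul, coord_v₁ h, if_pos rfl, sub_eq_zero] at h1
  rw [proj, dif_pos hex, h1]
  simp

theorem ofReal_proj (h : IsIntegral ℤ β) (x : Fin (deg β) → ℝ) :
    (proj β x : ℂ) = coord h (emb₁ β) x := by
  rw [proj_eq_re h, coord_emb₁_re]

theorem coord_Psi (h : IsIntegral ℤ β) (j : Emb β) (a : ℝ) : coord h j (Psi β a) = Gam β j a := by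
  have := finite_emb h
  have := Fintype.ofFinite (Emb β)
  refine coord_eq_of_re_sum h (f := fun j => Gam β j a) (fun j => Gam_conjEmb j a) (fun i => ?_) j
  rw [Psi, finsum_eq_sum_of_fintype]

/-! ### Coordinates of `ψ(u)` -/

theorem norm_conj_lt_one (hβ : IsPisotUnit β) {j : Emb β} (hj : j ≠ emb₁ β) : ‖conj β j‖ < 1 :=
  hβ.norm_lt_one _ (aeval_conj j) fun h => hj (conj_injective β (h.trans conj_emb₁.symm))

theorem conj_ne_zero (hβ : IsPisotUnit β) (j : Emb β) : conj β j ≠ 0 := by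
  intro h
  have h1 : IntermediateField.AdjoinSimple.gen ℚ β = 0 := j.injective (by rw [map_zero]; exact h)
  have h2 : β = 0 := congrArg Subtype.val h1
  linarith [hβ.one_lt]

theorem coord_psi (h : IsIntegral ℤ β) {u : ℤ → ℝ}
    (hu : ∀ j : Emb β, j ≠ emb₁ β → Summable fun n : ℕ => Gam β j (u (-(n : ℤ))) * conj β j ^ n)
    (j : Emb β) [Decidable (j = emb₁ β)] :
    coord h j (psi β u) = if j = emb₁ β then ((∑' n : ℕ, u (n + 1) / β ^ (n + 1) : ℝ) : ℂ)
      else -∑' n : ℕ, Gam β j (u (-(n : ℤ))) * conj β j ^ n := by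
  classical
  have := finite_emb h
  have := Fintype.ofFinite (Emb β)
  rw [coord_eq_of_re_sum h (f := fun j => if j = emb₁ β then
      ((∑' n : ℕ, u (n + 1) / β ^ (n + 1) : ℝ) : ℂ)
      else -∑' n : ℕ, Gam β j (u (-(n : ℤ))) * conj β j ^ n) (fun j => ?_) (fun i => ?_)]
  · congr
  · by_cases hj : j = emb₁ β
    · simp only [hj, conjEmb_emb₁, if_true]
      exact (Complex.conj_ofReal _).symm
    · rw [if_neg hj, if_neg (conjEmb_ne_emb₁.2 hj), star_neg, tsum_star]
      simp [Gam_conjEmb, conj_conjEmb]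
  · have h1 : ∀ n : ℕ, (∑ᶠ (j : Emb β) (_ : j ≠ emb₁ β),
        Gam β j (u (-(n : ℤ))) * conj β j ^ n * eigvec β j i) =
        ∑ j ∈ Finset.univ.erase (emb₁ β), Gam β j (u (-(n : ℤ))) * conj β j ^ n * eigvec β j i := by
      intro n
      rw [← finsum_mem_coe_finset]
      simp
    have h2 : ∀ j ∈ Finset.univ.erase (emb₁ β),
        Summable fun n : ℕ => Gam β j (u (-(n : ℤ))) * conj β j ^ n * eigvec β j i :=
      fun j hj => (hu j (Finset.mem_erase.1 hj).1).mul_right _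
    rw [psi]
    simp only [h1]
    rw [← Complex.re_tsum (summable_sum h2), Summable.tsum_finsetSum h2,
      ← Finset.add_sum_erase _ _ (Finset.mem_univ (emb₁ β)), if_pos rfl, Complex.add_re,
      Complex.re_ofReal_mul, v₁, sub_eq_add_neg, ← Complex.neg_re, ← Finset.sum_neg_distrib]
    congr 2
    refine Finset.sum_congr rfl fun j hj => ?_
    rw [if_neg (Finset.mem_erase.1 hj).1, tsum_mul_right, neg_mul]

/-! ### The companion matrix is unimodular -/

/-- The companion matrix as an integer matrix. -/
def companionInt (β : ℝ) : Matrix (Fin (deg β)) (Fin (deg β)) ℤ := fun i k =>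
  if (i : ℕ) = 0 then -(minpoly ℤ β).coeff (deg β - 1 - k)
  else if (i : ℕ) = k + 1 then 1 else 0

theorem map_companionInt : (Int.castRingHom ℝ).mapMatrix (companionInt β) = companion β := by
  ext i k
  simp only [RingHom.mapMatrix_apply, Matrix.map_apply, companionInt, companion]
  split_ifs <;> simp

theorem coord_map_aeval_mulVec (h : IsIntegral ℤ β) (j : Emb β) (P : Polynomial ℤ)
    (x : Fin (deg β) → ℝ) :
    coord h j ((Int.castRingHom ℝ).mapMatrix (Polynomial.aeval (companionInt β) P) *ᵥ x) =
      Polynomial.aeval (conj β j) P * coord h j x := by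
  induction P using Polynomial.induction_on' generalizing x with
  | add p q hp hq => simp only [map_add, Matrix.add_mulVec, hp, hq, add_mul]
  | monomial n a =>
    induction n generalizing x with
    | zero =>
      have : (Int.castRingHom ℝ).mapMatrix (algebraMap ℤ (Matrix (Fin (deg β)) (Fin (deg β)) ℤ) a)
          *ᵥ x = (a : ℝ) • x := by
        have : (Int.castRingHom ℝ).mapMatrix
            (algebraMap ℤ (Matrix (Fin (deg β)) (Fin (deg β)) ℤ) a) = (a : ℝ) • 1 := by
          ext i k
          by_cases hik : i = k <;> simp [hik, Matrix.intCast_apply]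
        rw [this, Matrix.smul_mulVec, Matrix.one_mulVec]
      rw [Polynomial.monomial_zero_left, Polynomial.aeval_C, this, map_smul, Polynomial.aeval_C]
      simp
    | succ n ih =>
      rw [← Polynomial.monomial_mul_X, map_mul, map_mul, Polynomial.aeval_X, map_companionInt,
        ← Matrix.mulVec_mulVec, ih, coord_mulVec, map_mul, Polynomial.aeval_X]
      ring

/-- On the `j`-th coordinate the matrix acts as multiplication by the minimal polynomial evaluated
at its root `β_j`. -/
theorem aeval_companionInt (h : IsIntegral ℤ β) :
    Polynomial.aeval (companionInt β) (minpoly ℤ β) = 0 := by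
  have h1 : (Int.castRingHom ℝ).mapMatrix
      (Polynomial.aeval (companionInt β) (minpoly ℤ β)) = 0 := by
    apply Matrix.mulVec_injective
    ext1 x
    refine coord_ext h fun j => ?_
    rw [coord_map_aeval_mulVec, aeval_conj]
    simp
  ext i k
  have := congrFun (congrFun h1 i) k
  simpa using this

/-- Writing the minimal polynomial as `X * divX + c` with `c = ±1`, its vanishing at the matrix
exhibits `-c • divX` as an integral inverse. This is where the unit hypothesis enters. -/
theorem exists_companionInt_mul_eq_one (hβ : IsPisotUnit β) :
    ∃ N : Matrix (Fin (deg β)) (Fin (deg β)) ℤ, companionInt β * N = 1 := by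
  have h1 := aeval_companionInt hβ.isIntegral
  rw [← Polynomial.X_mul_divX_add (minpoly ℤ β), map_add, map_mul, Polynomial.aeval_X,
    Polynomial.aeval_C] at h1
  refine ⟨-(minpoly ℤ β).coeff 0 • Polynomial.aeval (companionInt β) (minpoly ℤ β).divX, ?_⟩
  have h2 : (minpoly ℤ β).coeff 0 * (minpoly ℤ β).coeff 0 = 1 := by
    rw [← abs_mul_abs_self, hβ.abs_coeff_zero, mul_one]
  rw [mul_smul_comm, eq_neg_of_add_eq_zero_left h1, Algebra.algebraMap_eq_smul_one, smul_neg,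
    neg_smul, neg_neg, smul_smul, h2, one_smul]

theorem abs_det_companion (hβ : IsPisotUnit β) : |(companion β).det| = 1 := by
  obtain ⟨N, hN⟩ := exists_companionInt_mul_eq_one hβ
  have h1 := congrArg Matrix.det hN
  rw [Matrix.det_mul, Matrix.det_one] at h1
  have h2 : |(companionInt β).det| = 1 := Int.isUnit_iff_abs_eq.1 (IsUnit.of_mul_eq_one _ h1)
  rw [← map_companionInt, ← RingHom.map_det]
  rw [eq_intCast, ← Int.cast_abs, h2, Int.cast_one]

/-! ### The lattice `q⁻¹ ℤ^d` -/

/-- The lattice `q⁻¹ ℤ^d`. -/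
def lattice (d q : ℕ) : AddSubgroup (Fin d → ℝ) where
  carrier := {x | ∀ i, ∃ z : ℤ, q * x i = z}
  zero_mem' i := ⟨0, by simp⟩
  add_mem' hx hy i := by
    obtain ⟨z, hz⟩ := hx i
    obtain ⟨w, hw⟩ := hy i
    exact ⟨z + w, by simp [mul_add, hz, hw]⟩
  neg_mem' hx i := by
    obtain ⟨z, hz⟩ := hx i
    exact ⟨-z, by simp [hz]⟩

theorem lattice_le_of_dvd {d q r : ℕ} (h : q ∣ r) : lattice d q ≤ lattice d r := by
  obtain ⟨s, rfl⟩ := h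
  intro x hx i
  obtain ⟨z, hz⟩ := hx i
  exact ⟨s * z, by push_cast; rw [← hz]; ring⟩

theorem map_mulVec_mem_lattice {d q : ℕ} (N : Matrix (Fin d) (Fin d) ℤ) {x : Fin d → ℝ}
    (hx : x ∈ lattice d q) : (Int.castRingHom ℝ).mapMatrix N *ᵥ x ∈ lattice d q := by
  intro i
  choose z hz using hx
  refine ⟨∑ k, N i k * z k, ?_⟩
  simp only [Matrix.mulVec, dotProduct, Finset.mul_sum, Int.cast_sum, Int.cast_mul, ← hz]
  refine Finset.sum_congr rfl fun k _ => ?_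
  simp; ring

theorem finite_lattice_inter {d q : ℕ} (hq : 0 < q) {s : Set (Fin d → ℝ)}
    (hs : Bornology.IsBounded s) : ((lattice d q : Set (Fin d → ℝ)) ∩ s).Finite := by
  obtain ⟨C, hC⟩ := hs.subset_closedBall 0
  have hq' : (0 : ℝ) < q := by exact_mod_cast hq
  refine ((Set.finite_Icc (fun _ : Fin d => -⌈q * C⌉) (fun _ => ⌈q * C⌉)).image
    (fun z i => (z i : ℝ) / q)).subset ?_
  rintro x ⟨hx, hxs⟩
  choose z hz using hx
  have hb : ∀ i, |(z i : ℝ)| ≤ (⌈q * C⌉ : ℤ) := by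
    intro i
    have h1 := hC hxs
    rw [mem_closedBall_zero_iff] at h1
    have h2 := (norm_le_pi_norm x i).trans h1
    rw [← hz, abs_mul, Nat.abs_cast]
    exact (mul_le_mul_of_nonneg_left h2 hq'.le).trans (Int.le_ceil _)
  refine ⟨z, ⟨fun i => ?_, fun i => ?_⟩, ?_⟩
  · have := (abs_le.1 (hb i)).1
    exact_mod_cast this
  · have := (abs_le.1 (hb i)).2
    exact_mod_cast this
  · ext i
    simp only [← hz]; field_simp

theorem countable_lattice {d q : ℕ} (hq : 0 < q) : (lattice d q : Set (Fin d → ℝ)).Countable := by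
  have : (lattice d q : Set (Fin d → ℝ)) = ⋃ n : ℕ, (lattice d q : Set (Fin d → ℝ)) ∩
      Metric.closedBall 0 n := by
    rw [← inter_iUnion, Metric.iUnion_closedBall_nat, inter_univ]
  rw [this]
  exact countable_iUnion fun n =>
    (finite_lattice_inter hq Metric.isBounded_closedBall).countable

theorem exists_lattice_norm_add_le {d q : ℕ} (x : Fin d → ℝ) :
    ∃ y ∈ lattice d q, ‖x + y‖ ≤ 1 := by
  refine ⟨fun i => -(⌊x i⌋ : ℝ), fun i => ⟨-q * ⌊x i⌋, by push_cast; ring⟩, ?_⟩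
  rw [pi_norm_le_iff_of_nonneg zero_le_one]
  intro i
  rw [Pi.add_apply, ← sub_eq_add_neg, Int.self_sub_floor, Real.norm_eq_abs,
    abs_of_nonneg (Int.fract_nonneg _)]
  exact (Int.fract_lt_one _).le

/-! ### Polynomials in `β` and denominators of the vectors `Ψ(a)` -/

theorem mem_QBeta_iff (h : IsIntegral ℤ β) {a : ℝ} :
    a ∈ QBeta β ↔ ∃ P : Polynomial ℚ, Polynomial.aeval β P = a := by
  have : IsAlgebraic ℚ β := (h.tower_top (A := ℚ)).isAlgebraic
  rw [← IntermediateField.mem_toSubalgebra,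
    IntermediateField.adjoin_simple_toSubalgebra_of_isAlgebraic this,
    Algebra.adjoin_singleton_eq_range_aeval]
  rfl

theorem aeval_mem_QBeta (P : Polynomial ℤ) : Polynomial.aeval β P ∈ QBeta β := by
  rw [show Polynomial.aeval β P = Polynomial.aeval β (P.map (algebraMap ℤ ℚ)) from
    (Polynomial.aeval_map_algebraMap ℚ β P).symm]
  exact (IntermediateField.algebra_adjoin_le_adjoin ℚ {β})
    (Polynomial.aeval_mem_adjoin_singleton ℚ β)

theorem Gam_aeval (j : Emb β) (P : Polynomial ℤ) :
    Gam β j (Polynomial.aeval β P) = Polynomial.aeval (conj β j) P := by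
  rw [Gam_of_mem (aeval_mem_QBeta P)]
  have h1 : (⟨Polynomial.aeval β P, aeval_mem_QBeta P⟩ : QBeta β) =
      Polynomial.aeval (IntermediateField.AdjoinSimple.gen ℚ β) P := by
    apply Subtype.ext
    exact Polynomial.aeval_algHom_apply ((QBeta β).val.restrictScalars ℤ)
      (IntermediateField.AdjoinSimple.gen ℚ β) P
  rw [h1]
  exact (Polynomial.aeval_algHom_apply (j.restrictScalars ℤ)
      (IntermediateField.AdjoinSimple.gen ℚ β) P).symm

theorem Gam_natCast_mul {a : ℝ} (ha : a ∈ QBeta β) (q : ℕ) (j : Emb β) :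
    Gam β j (q * a) = q * Gam β j a := by
  rw [Gam_of_mem ha, Gam_of_mem (mul_mem (natCast_mem _ q) ha)]
  rw [← map_natCast j, ← map_mul]
  rfl

/-- Clear denominators: `q a = Q'(β)` with `Q'` integral. Then `q Ψ(a)` is the integer matrix
`Q'(M_β)` applied to an integer vector. -/
theorem exists_Psi_mem_lattice (h : IsIntegral ℤ β) {a : ℝ} (ha : a ∈ QBeta β) :
    ∃ q : ℕ, 0 < q ∧ Psi β a ∈ lattice (deg β) q := by
  have := finite_emb h
  have := Fintype.ofFinite (Emb β)
  obtain ⟨P, hP⟩ := (mem_QBeta_iff h).1 ha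
  obtain ⟨b, hbm, hb⟩ := IsLocalization.integerNormalization_spec (nonZeroDivisors ℤ) P
  set Q := IsLocalization.integerNormalization (nonZeroDivisors ℤ) P
  obtain ⟨q, hq, Q', hQ'⟩ : ∃ q : ℕ, 0 < q ∧ ∃ Q' : Polynomial ℤ,
      Polynomial.aeval β Q' = q * a := by
    have h1 : Polynomial.aeval β Q = b * a := by
      have := congrArg (Polynomial.aeval β) hb
      rw [Polynomial.aeval_map_algebraMap] at this
      rw [this, ← hP]
      simp
    have hb0 : b ≠ 0 := nonZeroDivisors.ne_zero hbm
    refine ⟨b.natAbs, Int.natAbs_pos.2 hb0, ?_⟩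
    rcases Int.natAbs_eq b with h2 | h2
    · refine ⟨Q, ?_⟩
      rw [h1]; nth_rw 1 [h2]; simp
    · refine ⟨-Q, ?_⟩
      rw [map_neg, h1]; nth_rw 1 [h2]; simp
  refine ⟨q, hq, ?_⟩
  -- By the normalization `v_1 + ⋯ + v_d = e`, all coordinates of `e` are `1`.
  set e : Fin (deg β) → ℝ := fun i => if (i : ℕ) = 0 then 1 else 0 with he
  have hce : ∀ j, coord h j e = 1 := by
    intro j
    refine coord_eq_of_sum h (f := fun _ => 1) (fun i => ?_) j
    have := finsum_eigvec h i
    rw [finsum_eq_sum_of_fintype] at this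
    simp only [one_mul, this, he]
    split_ifs <;> simp
  have hel : e ∈ lattice (deg β) 1 := fun i => by
    by_cases hi : (i : ℕ) = 0
    · exact ⟨1, by simp [he, hi]⟩
    · exact ⟨0, by simp [he, hi]⟩
  have key : (q : ℝ) • Psi β a =
      (Int.castRingHom ℝ).mapMatrix (Polynomial.aeval (companionInt β) Q') *ᵥ e := by
    refine coord_ext h fun j => ?_
    rw [coord_map_aeval_mulVec, hce, mul_one, map_smul, coord_Psi, ← Gam_aeval, hQ',
      Gam_natCast_mul ha]
    simp
  intro i
  have h3 := map_mulVec_mem_lattice (Polynomial.aeval (companionInt β) Q') hel i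
  rw [← key] at h3
  simpa using h3

theorem exists_forall_Psi_mem_lattice (h : IsIntegral ℤ β) (A : Finset ℝ)
    (hA : ∀ a ∈ A, a ∈ QBeta β) :
    ∃ q : ℕ, 0 < q ∧ ∀ a ∈ A, Psi β a ∈ lattice (deg β) q := by
  have h1 : ∀ a : ℝ, ∃ q : ℕ, 0 < q ∧ (a ∈ A → Psi β a ∈ lattice (deg β) q) := by
    intro a
    by_cases ha : a ∈ A
    · obtain ⟨q, hq, hq'⟩ := exists_Psi_mem_lattice h (hA a ha)
      exact ⟨q, hq, fun _ => hq'⟩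
    · exact ⟨1, one_pos, fun h => absurd h ha⟩
  choose q hq hqA using h1
  exact ⟨∏ a ∈ A, q a, Finset.prod_pos fun a _ => hq a, fun a ha =>
    lattice_le_of_dvd (Finset.dvd_prod_of_mem q ha) (hqA a ha)⟩

/-! ### Continuity of the coordinates and a relative density property of the lattice -/

theorem continuous_coord (h : IsIntegral ℤ β) (j : Emb β) : Continuous (coord h j) :=
  LinearMap.continuous_of_finiteDimensional _

theorem exists_norm_coord_le (h : IsIntegral ℤ β) :
    ∃ C : ℝ, 0 < C ∧ ∀ j x, ‖coord h j x‖ ≤ C * ‖x‖ := by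
  have := finite_emb h
  have := Fintype.ofFinite (Emb β)
  refine ⟨1 + ∑ j, ‖LinearMap.toContinuousLinearMap (coord h j)‖, by positivity, fun j x => ?_⟩
  refine ((LinearMap.toContinuousLinearMap (coord h j)).le_opNorm x).trans ?_
  gcongr
  have := Finset.single_le_sum
    (f := fun j => ‖LinearMap.toContinuousLinearMap (coord h j)‖) (fun _ _ => norm_nonneg _)
    (Finset.mem_univ j)
  linarith

theorem exists_norm_le_of_coord (h : IsIntegral ℤ β) :
    ∃ C : ℝ, 0 < C ∧ ∀ r x, (∀ j, ‖coord h j x‖ ≤ r) → ‖x‖ ≤ C * r := by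
  have := finite_emb h
  have := Fintype.ofFinite (Emb β)
  refine ⟨1 + ∑ j, ‖eigvec β j‖, by positivity, fun r x hx => ?_⟩
  have hr : 0 ≤ r := (norm_nonneg _).trans (hx (emb₁ β))
  refine (pi_norm_le_iff_of_nonneg (by positivity)).2 fun i => ?_
  have h1 : ‖x i‖ = ‖(x i : ℂ)‖ := by simp
  rw [h1, ← sum_coord h]
  refine (norm_sum_le _ _).trans ?_
  calc ∑ j, ‖coord h j x * eigvec β j i‖ ≤ ∑ j, r * ‖eigvec β j‖ := by
        refine Finset.sum_le_sum fun j _ => ?_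
        rw [norm_mul]
        exact mul_le_mul (hx j) (norm_le_pi_norm _ _) (norm_nonneg _) hr
    _ ≤ _ := by rw [← Finset.mul_sum]; nlinarith

theorem coord_pow_mulVec (h : IsIntegral ℤ β) (j : Emb β) (m : ℕ) (x : Fin (deg β) → ℝ) :
    coord h j ((companion β) ^ m *ᵥ x) = conj β j ^ m * coord h j x := by
  induction m with
  | zero => simp
  | succ m ih => rw [pow_succ', ← Matrix.mulVec_mulVec, coord_mulVec, ih, pow_succ']; ring

theorem exists_lattice_pow_mulVec_eq (hβ : IsPisotUnit β) {q : ℕ} (m : ℕ) {x : Fin (deg β) → ℝ}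
    (hx : x ∈ lattice (deg β) q) : ∃ y ∈ lattice (deg β) q, (companion β) ^ m *ᵥ y = x := by
  obtain ⟨N, hN⟩ := exists_companionInt_mul_eq_one hβ
  refine ⟨(Int.castRingHom ℝ).mapMatrix (N ^ m) *ᵥ x, map_mulVec_mem_lattice _ hx, ?_⟩
  have hc : Commute (companionInt β) N := (hN.trans (mul_eq_one_comm.1 hN).symm)
  rw [← map_companionInt, ← map_pow, Matrix.mulVec_mulVec, ← map_mul, ← hc.mul_pow, hN, one_pow,
    map_one, Matrix.one_mulVec]

/-- The slab over `[l, r)` may be thin, but `M_β^m` widens it until rounding to an integer vector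
stays inside. Pulling back by `M_β^m` keeps the correction in the lattice, by unimodularity. -/
theorem exists_lattice_add_mem (hβ : IsPisotUnit β) (q : ℕ) {l r : ℝ} (hlr : l < r) :
    ∃ R : ℝ, ∀ x : Fin (deg β) → ℝ, ∃ y ∈ lattice (deg β) q, proj β (x + y) ∈ Ico l r ∧
      ∀ j ≠ emb₁ β, ‖coord hβ.isIntegral j (x + y)‖ ≤ R := by
  classical
  set h := hβ.isIntegral
  have := finite_emb h
  have := Fintype.ofFinite (Emb β)
  obtain ⟨C, hC, hCb⟩ := exists_norm_coord_le h
  have hβ1 := hβ.one_lt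
  obtain ⟨m, hm⟩ : ∃ m : ℕ, C / ((r - l) / 2) < β ^ m := pow_unbounded_of_one_lt _ hβ1
  -- Pulling back enlarges the `j`-th contracting coordinate by `|β_j|^(-m)`. As `m` depends only on
  -- `r - l`, so does not vary with `x`, the bound is uniform.
  refine ⟨∑ j, C / ‖conj β j‖ ^ m, fun x => ?_⟩
  -- Recentering at the midpoint of `[l, r)`: an error below `(r - l)/2` along `v_1` is then
  -- harmless.
  set w : Fin (deg β) → ℝ := x - ((l + r) / 2) • v₁ β with hw
  obtain ⟨y', hy', hn⟩ := exists_lattice_norm_add_le (q := q) ((companion β) ^ m *ᵥ w)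
  obtain ⟨y, hy, rfl⟩ := exists_lattice_pow_mulVec_eq hβ m hy'
  rw [← Matrix.mulVec_add] at hn
  have key : ∀ j, ‖coord h j (w + y)‖ ≤ C / ‖conj β j‖ ^ m := by
    intro j
    have h1 := hCb j ((companion β) ^ m *ᵥ (w + y))
    rw [coord_pow_mulVec, norm_mul, norm_pow] at h1
    have h2 : 0 < ‖conj β j‖ ^ m := pow_pos (norm_pos_iff.2 (conj_ne_zero hβ j)) _
    rw [le_div_iff₀ h2, mul_comm]
    refine h1.trans ?_
    nlinarith
  have hxy : x + y = (w + y) + ((l + r) / 2) • v₁ β := by rw [hw]; abel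
  refine ⟨y, hy, ?_, fun j hj => ?_⟩
  · have h1 := key (emb₁ β)
    have h2 : proj β (x + y) = proj β (w + y) + (l + r) / 2 := by
      rw [proj_eq_re h, proj_eq_re h, hxy, map_add, map_smul, coord_v₁ h, if_pos rfl]
      simp
    rw [← ofReal_proj, conj_emb₁, Complex.norm_real, Complex.norm_real, Real.norm_eq_abs,
      Real.norm_eq_abs, abs_of_pos (by linarith : 0 < β)] at h1
    have h3 : C / β ^ m < (r - l) / 2 := by
      have hp : 0 < β ^ m := by positivity
      rw [div_lt_iff₀ (by linarith)] at hm
      rw [div_lt_iff₀ hp]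
      linarith
    have h4 := abs_lt.1 (h1.trans_lt h3)
    rw [h2]
    constructor <;> linarith [h4.1, h4.2]
  · rw [hxy, map_add, map_smul, coord_v₁ h, if_neg hj, smul_zero, add_zero]
    exact (key j).trans (Finset.single_le_sum (f := fun j => C / ‖conj β j‖ ^ m)
      (fun _ _ => by positivity) (Finset.mem_univ j))

/-! ### The projection and the branches -/

/-- The projection `π_1` as a continuous linear map. -/
def projL (h : IsIntegral ℤ β) : (Fin (deg β) → ℝ) →L[ℝ] ℝ :=
  LinearMap.toContinuousLinearMap (Complex.reLm ∘ₗ coord h (emb₁ β))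

theorem projL_apply (h : IsIntegral ℤ β) (x : Fin (deg β) → ℝ) : projL h x = proj β x :=
  (proj_eq_re h x).symm

theorem coe_projL (h : IsIntegral ℤ β) : ⇑(projL h) = proj β := funext (projL_apply h)

theorem continuous_proj (h : IsIntegral ℤ β) : Continuous (proj β) :=
  coe_projL h ▸ (projL h).continuous

theorem surjective_projL (h : IsIntegral ℤ β) : Function.Surjective (projL h) := by
  classical
  intro t
  refine ⟨t • v₁ β, ?_⟩
  rw [projL_apply, proj_eq_re h, map_smul, coord_v₁ h, if_pos rfl]
  simp

/-- A surjective linear map sends Lebesgue measure to a multiple of Lebesgue measure, possibly an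
infinite one. This makes preimages of Lebesgue measurable sets Lebesgue measurable. -/
theorem quasiMeasurePreserving_proj (h : IsIntegral ℤ β) :
    Measure.QuasiMeasurePreserving (proj β) volume volume := by
  refine ⟨(continuous_proj h).measurable, ?_⟩
  obtain ⟨c, -, hc⟩ := LinearMap.exists_map_addHaar_eq_smul_addHaar (projL h).toLinearMap
    volume volume (surjective_projL h)
  have : ⇑(projL h).toLinearMap = proj β := coe_projL h
  rw [this] at hc
  rw [hc]
  exact Measure.smul_absolutelyContinuous

/-- The affine map `x ↦ M_β x - Ψ(a)`. -/
def branch (hβ : IsPisotUnit β) (a : ℝ) : (Fin (deg β) → ℝ) ≃ᵐ (Fin (deg β) → ℝ) :=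
  (((Matrix.toLin' (companion β)).equivOfDetNeZero (by
      rw [LinearMap.det_toLin', ← abs_pos, abs_det_companion hβ]; exact one_pos)
    ).toContinuousLinearEquiv.toHomeomorph.trans (Homeomorph.subRight (Psi β a))).toMeasurableEquiv

theorem branch_apply (hβ : IsPisotUnit β) (a : ℝ) (x : Fin (deg β) → ℝ) :
    branch hβ a x = companion β *ᵥ x - Psi β a := rfl

theorem measurePreserving_branch (hβ : IsPisotUnit β) (a : ℝ) :
    MeasurePreserving (branch hβ a) volume volume := by
  have h1 : MeasurePreserving (Matrix.toLin' (companion β)) volume volume := by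
    refine ⟨(LinearMap.continuous_of_finiteDimensional _).measurable, ?_⟩
    have hdet := abs_det_companion hβ
    rw [Real.map_matrix_volume_pi_eq_smul_volume_pi (by rw [← abs_pos, hdet]; exact one_pos),
      abs_inv, hdet]
    simp
  exact (measurePreserving_sub_right volume (Psi β a)).comp h1

theorem coord_branch (hβ : IsPisotUnit β) (a : ℝ) (j : Emb β) (x : Fin (deg β) → ℝ) :
    coord hβ.isIntegral j (branch hβ a x) =
      conj β j * coord hβ.isIntegral j x - Gam β j a := by
  rw [branch_apply, map_sub, coord_mulVec, coord_Psi]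

theorem proj_branch (hβ : IsPisotUnit β) {a : ℝ} (ha : a ∈ QBeta β) (x : Fin (deg β) → ℝ) :
    proj β (branch hβ a x) = β * proj β x - a := by
  have := coord_branch hβ a (emb₁ β) x
  rw [← ofReal_proj, ← ofReal_proj, conj_emb₁, Gam_emb₁ ha] at this
  exact_mod_cast this

/-! ### Backward orbits -/

/-- Otherwise each point of `s` leaves the decreasing sets at some stage, and after the last such
stage nothing of `s` is left. It plays the role of compactness for `lift`, which is not continuous.
-/
theorem exists_forall_of_antitone_of_finite {α : Type*} {s : Set α} (hs : s.Finite)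
    {t : ℕ → Set α} (ht : Antitone t) (h : ∀ n, (s ∩ t n).Nonempty) : ∃ x ∈ s, ∀ n, x ∈ t n := by
  by_contra! hc
  have h1 : ∀ x : α, ∃ n, x ∈ s → x ∉ t n := by
    intro x
    by_cases hx : x ∈ s
    · obtain ⟨n, hn⟩ := hc x hx
      exact ⟨n, fun _ => hn⟩
    · exact ⟨0, fun h => absurd h hx⟩
  choose n hn using h1
  obtain ⟨x, hx, hxt⟩ := h (hs.toFinset.sup n)
  exact hn x hx (ht (Finset.le_sup (hs.mem_toFinset.2 hx)) hxt)

theorem antitone_iterate_image {α : Type*} {F : α → α} {K : Set α} (hK : MapsTo F K K) :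
    Antitone fun n => F^[n] '' K := by
  refine antitone_nat_of_succ_le fun n => ?_
  rintro _ ⟨z, hz, rfl⟩
  exact ⟨F z, hK hz, (Function.iterate_succ_apply F n z).symm⟩

/-- A König argument: each point of the intersection has a preimage that is again in the
intersection, and preimages are chosen successively. -/
theorem exists_backward_orbit {α : Type*} {F : α → α} {K : Set α} (hK : MapsTo F K K)
    (hfin : ∀ y, (K ∩ F ⁻¹' {y}).Finite) {x : α} (hx : x ∈ ⋂ n, F^[n] '' K) :
    ∃ o : ℕ → α, o 0 = x ∧ ∀ n, o n ∈ K ∧ F (o (n + 1)) = o n := by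
  have step : ∀ y : (⋂ n, F^[n] '' K : Set α), ∃ z : (⋂ n, F^[n] '' K : Set α), F z = y := by
    rintro ⟨y, hy⟩
    rw [mem_iInter] at hy
    -- The finite fiber of `y` meets `F^[n] '' K` because `y` lies in `F^[n+1] '' K`.
    obtain ⟨z, hz, hz'⟩ := exists_forall_of_antitone_of_finite (hfin y)
      (antitone_iterate_image hK) (fun n => by
        obtain ⟨w, hw, hwy⟩ := hy (n + 1)
        rw [Function.iterate_succ_apply'] at hwy
        exact ⟨F^[n] w, ⟨hK.iterate n hw, hwy⟩, w, hw, rfl⟩)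
    exact ⟨⟨z, mem_iInter.2 hz'⟩, hz.2⟩
  choose g hg using step
  refine ⟨fun n => (g^[n] ⟨x, hx⟩ : (⋂ n, F^[n] '' K : Set α)), rfl, fun n => ⟨?_, ?_⟩⟩
  · have := mem_iInter.1 (g^[n] ⟨x, hx⟩).2 0
    simpa using this
  · simp only [Function.iterate_succ_apply']
    exact hg _

namespace RightContBetaTransformation

variable (T : RightContBetaTransformation β)

/-! ### The transformation `T` -/

theorem digit_mem {x : ℝ} (hx : x ∈ T.X) : T.digit x ∈ T.A ∧ x ∈ T.piece (T.digit x) := by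
  have h : ∃ a ∈ T.A, x ∈ T.piece a := by simpa [X] using hx
  rw [digit, dif_pos h]
  exact h.choose_spec

theorem piece_subset {a : ℝ} (ha : a ∈ T.A) : T.piece a ⊆ T.X :=
  subset_biUnion_of_mem (u := T.piece) (show a ∈ T.A from ha)

theorem digit_eq {a x : ℝ} (ha : a ∈ T.A) (hx : x ∈ T.piece a) : T.digit x = a := by
  obtain ⟨h1, h2⟩ := T.digit_mem (T.piece_subset ha hx)
  by_contra hne
  exact (T.pairwiseDisjoint h1 ha hne).le_bot ⟨h2, hx⟩

theorem mapsTo_map : MapsTo T.map T.X T.X := by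
  intro x hx
  obtain ⟨h1, h2⟩ := T.digit_mem hx
  rw [X, ← T.image_eq]
  exact mem_biUnion (x := T.digit x) h1 ⟨x, h2, rfl⟩

theorem measurableSet_piece {a : ℝ} (ha : a ∈ T.A) : MeasurableSet (T.piece a) := by
  obtain ⟨I, hI⟩ := T.piece_eq a ha
  rw [hI]
  exact Finset.measurableSet_biUnion _ fun _ _ => measurableSet_Ico

theorem measurableSet_X : MeasurableSet T.X :=
  Finset.measurableSet_biUnion _ fun _ ha => T.measurableSet_piece ha

theorem exists_bound : ∃ B : ℝ, 0 ≤ B ∧ ∀ x ∈ T.X, |x| ≤ B := by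
  have : Bornology.IsBounded T.X := by
    rw [X, Bornology.isBounded_biUnion_finset]
    intro a ha
    obtain ⟨I, hI⟩ := T.piece_eq a ha
    rw [hI, Bornology.isBounded_biUnion_finset]
    exact fun p _ => Metric.isBounded_Ico _ _
  obtain ⟨B, hB, h⟩ := this.exists_pos_norm_le
  exact ⟨B, hB.le, h⟩

theorem exists_Ico_subset : ∃ l r : ℝ, l < r ∧ Ico l r ⊆ T.X := by
  obtain ⟨a, ha⟩ := T.A_nonempty
  obtain ⟨x, hx⟩ := T.piece_nonempty a ha
  obtain ⟨I, hI⟩ := T.piece_eq a ha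
  rw [hI, mem_iUnion₂] at hx
  obtain ⟨p, hp, hx⟩ := hx
  refine ⟨p.1, p.2, hx.1.trans_lt hx.2, Subset.trans ?_ (T.piece_subset ha)⟩
  rw [hI]
  exact subset_biUnion_of_mem (u := fun p : ℝ × ℝ => Ico p.1 p.2) (show p ∈ I from hp)

/-- The partial sums telescope to `x - T^n x / β^n`, and orbits are bounded. -/
theorem hasSum_expansion (hβ : 1 < β) {x : ℝ} (hx : x ∈ T.X) :
    HasSum (fun n => T.expansion x n / β ^ (n + 1)) x := by
  have hβ0 : β ≠ 0 := by positivity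
  obtain ⟨B, hB, hXB⟩ := T.exists_bound
  have hsum : ∀ n, ∑ i ∈ Finset.range n, T.expansion x i / β ^ (i + 1) =
      x - T.map^[n] x / β ^ n := by
    intro n
    induction n with
    | zero => simp
    | succ n ih =>
      rw [Finset.sum_range_succ, ih, Function.iterate_succ_apply', map, expansion]
      field_simp
      ring
  have hz : Filter.Tendsto (fun n => T.map^[n] x / β ^ n) Filter.atTop (nhds 0) := by
    refine squeeze_zero_norm (a := fun n => B * (β⁻¹) ^ n) (fun n => ?_) ?_
    · rw [norm_div, norm_pow, inv_pow, Real.norm_of_nonneg (by positivity : 0 ≤ β), div_eq_mul_inv]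
      have := hXB _ (T.mapsTo_map.iterate n hx)
      gcongr
      exact this
    · simpa using (tendsto_pow_atTop_nhds_zero_of_lt_one (by positivity)
        (inv_lt_one_of_one_lt₀ hβ)).const_mul B
  have hs : Summable fun n => T.expansion x n / β ^ (n + 1) := by
    obtain ⟨D, hD⟩ : ∃ D, ∀ a ∈ T.A, |a| ≤ D :=
      ⟨∑ a ∈ T.A, |a|, fun a ha => Finset.single_le_sum (f := fun a => |a|)
        (fun _ _ => abs_nonneg _) ha⟩
    refine Summable.of_norm_bounded (g := fun n => D * (β⁻¹) ^ (n + 1))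
      (Summable.mul_left _ ((summable_nat_add_iff 1).2 (summable_geometric_of_lt_one
        (by positivity) (inv_lt_one_of_one_lt₀ hβ)))) fun n => ?_
    rw [norm_div, norm_pow, inv_pow, Real.norm_of_nonneg (by positivity : 0 ≤ β), div_eq_mul_inv]
    have := hD _ (T.digit_mem (T.mapsTo_map.iterate n hx)).1
    gcongr
    exact this
  rw [hs.hasSum_iff_tendsto_nat]
  simp only [hsum]
  simpa using hz.const_sub x

theorem expansion_injOn (hβ : 1 < β) : InjOn T.expansion T.X := fun _ hx _ hy h =>
  (T.hasSum_expansion hβ hx).unique (h ▸ T.hasSum_expansion hβ hy)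

theorem expansion_map (x : ℝ) (n : ℕ) : T.expansion (T.map x) n = T.expansion x (n + 1) := rfl

/-- A point is determined by its expansion, so the points of `X` realizing the different tails
automatically form one two-sided orbit. -/
theorem mem_twoSided_iff (hβ : 1 < β) {u : ℤ → ℝ} : u ∈ T.twoSided ↔
    ∃ x : ℤ → ℝ, ∀ k, x k ∈ T.X ∧ T.map (x k) = x (k + 1) ∧ u k = T.digit (x k) := by
  constructor
  · intro hu
    choose x hx hxu using hu
    refine ⟨x, fun k => ⟨hx k, ?_, ?_⟩⟩
    · refine T.expansion_injOn hβ (T.mapsTo_map (hx k)) (hx (k + 1)) ?_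
      ext n
      rw [expansion_map, ← hxu, ← hxu]
      push_cast
      ring_nf
    · have := congrFun (hxu k) 0
      simpa [expansion] using this
  · rintro ⟨x, hx⟩ k
    refine ⟨x k, (hx k).1, ?_⟩
    have hit : ∀ n : ℕ, T.map^[n] (x k) = x (k + n) := by
      intro n
      induction n with
      | zero => simp
      | succ n ih => rw [Function.iterate_succ_apply', ih, (hx _).2.1]; push_cast; ring_nf
    ext n
    rw [expansion, hit, (hx _).2.2]

theorem twoSided_shift {u : ℤ → ℝ} (hu : u ∈ T.twoSided) (m : ℤ) :
    (fun k => u (k + m)) ∈ T.twoSided := by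
  intro k
  convert hu (k + m) using 3
  ring

theorem apply_mem_of_mem_twoSided {u : ℤ → ℝ} (hu : u ∈ T.twoSided) (k : ℤ) : u k ∈ T.A := by
  obtain ⟨x, hx, hxu⟩ := hu k
  have := congrFun hxu 0
  simp only [Nat.cast_zero, add_zero] at this
  rw [this]
  exact (T.digit_mem hx).1

/-! ### The lifted transformation and its absorbing sets -/

/-- The lift `x ↦ M_β x - Ψ(a)`, `π_1(x) ∈ X_a`, of `T`. -/
def lift (hβ : IsPisotUnit β) (x : Fin (deg β) → ℝ) : Fin (deg β) → ℝ := branch hβ (T.digit (proj β x)) x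

/-- The points over `X` with all contracting coordinates bounded by `R`. -/
def trap (hβ : IsPisotUnit β) (R : ℝ) : Set (Fin (deg β) → ℝ) :=
  {x | proj β x ∈ T.X ∧ ∀ j ≠ emb₁ β, ‖coord hβ.isIntegral j x‖ ≤ R}

/-- The radius `R` is large enough for `trap R` to be forward invariant. -/
def IsTrapRadius (R : ℝ) : Prop :=
  0 ≤ R ∧ ∀ a ∈ T.A, ∀ j : Emb β, j ≠ emb₁ β → ‖conj β j‖ * R + ‖Gam β j a‖ ≤ R

theorem exists_isTrapRadius (hβ : IsPisotUnit β) (R₀ : ℝ) : ∃ R, R₀ ≤ R ∧ T.IsTrapRadius R := by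
  have := finite_emb hβ.isIntegral
  have := Fintype.ofFinite (Emb β)
  -- The needed bound is `R ≥ |Γ_j(a)| / (1 - |β_j|)` for `j ≠ 1`. The absolute value keeps the
  -- summand at `emb₁ β`, where `1 - |β_j| < 0`, nonnegative.
  set S := ∑ a ∈ T.A, ∑ j : Emb β, ‖Gam β j a‖ / |1 - ‖conj β j‖| with hS
  have hS0 : 0 ≤ S := Finset.sum_nonneg fun _ _ => Finset.sum_nonneg fun _ _ => by positivity
  refine ⟨|R₀| + S, by linarith [le_abs_self R₀], by positivity, fun a ha j hj => ?_⟩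
  have h1 := norm_conj_lt_one hβ hj
  have h2 : ‖Gam β j a‖ / (1 - ‖conj β j‖) ≤ S := by
    rw [← abs_of_pos (sub_pos.2 h1)]
    refine le_trans (Finset.single_le_sum (f := fun j => ‖Gam β j a‖ / |1 - ‖conj β j‖|)
      (fun _ _ => by positivity) (Finset.mem_univ j)) ?_
    exact Finset.single_le_sum
      (f := fun a => ∑ j : Emb β, ‖Gam β j a‖ / |1 - ‖conj β j‖|)
      (fun _ _ => Finset.sum_nonneg fun _ _ => by positivity) ha
  rw [div_le_iff₀ (sub_pos.2 h1)] at h2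
  nlinarith [abs_nonneg R₀]

theorem proj_lift (hβ : IsPisotUnit β) (hA : ∀ a ∈ T.A, a ∈ QBeta β) {x : Fin (deg β) → ℝ} (hx : proj β x ∈ T.X) :
    proj β (T.lift hβ x) = T.map (proj β x) :=
  proj_branch hβ (hA _ (T.digit_mem hx).1) x

theorem coord_lift (hβ : IsPisotUnit β) (j : Emb β) (x : Fin (deg β) → ℝ) :
    coord hβ.isIntegral j (T.lift hβ x) =
      conj β j * coord hβ.isIntegral j x - Gam β j (T.digit (proj β x)) :=
  coord_branch hβ _ j x

theorem mapsTo_lift (hβ : IsPisotUnit β) (hA : ∀ a ∈ T.A, a ∈ QBeta β) {R : ℝ} (hR : T.IsTrapRadius R) :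
    MapsTo (T.lift hβ) (T.trap hβ R) (T.trap hβ R) := by
  rintro x ⟨hx, hxj⟩
  refine ⟨T.proj_lift hβ hA hx ▸ T.mapsTo_map hx, fun j hj => ?_⟩
  rw [coord_lift]
  refine (norm_sub_le _ _).trans (le_trans ?_ (hR.2 _ (T.digit_mem hx).1 j hj))
  rw [norm_mul]
  gcongr
  exact hxj j hj

theorem finite_fiber (hβ : IsPisotUnit β) (R : ℝ) (y : Fin (deg β) → ℝ) :
    (T.trap hβ R ∩ T.lift hβ ⁻¹' {y}).Finite := by
  refine (T.A.finite_toSet.image fun a => (branch hβ a).symm y).subset ?_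
  rintro x ⟨hx, rfl⟩
  exact ⟨_, (T.digit_mem hx.1).1, (branch hβ _).symm_apply_apply x⟩

theorem norm_coord_le_of_mem_trap (hβ : IsPisotUnit β) : ∃ B : ℝ, ∀ R, ∀ x ∈ T.trap hβ R,
    ∀ j, ‖coord hβ.isIntegral j x‖ ≤ max B R := by
  obtain ⟨B, hB, hXB⟩ := T.exists_bound
  refine ⟨B, fun R x hx j => ?_⟩
  by_cases hj : j = emb₁ β
  · rw [hj, ← ofReal_proj, Complex.norm_real]
    exact (hXB _ hx.1).trans (le_max_left _ _)
  · exact (hx.2 j hj).trans (le_max_right _ _)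

theorem isBounded_trap (hβ : IsPisotUnit β) (R : ℝ) : Bornology.IsBounded (T.trap hβ R) := by
  obtain ⟨B, hB⟩ := T.norm_coord_le_of_mem_trap hβ
  obtain ⟨C, -, hC⟩ := exists_norm_le_of_coord hβ.isIntegral
  refine (Metric.isBounded_closedBall (x := 0) (r := C * max B R)).subset fun x hx => ?_
  rw [mem_closedBall_zero_iff]
  exact hC _ x (hB R x hx)

theorem measurableSet_trap (hβ : IsPisotUnit β) (R : ℝ) : MeasurableSet (T.trap hβ R) := by
  have := finite_emb hβ.isIntegral
  have : T.trap hβ R = proj β ⁻¹' T.X ∩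
      ⋂ j, ⋂ (_ : j ≠ emb₁ β), {x | ‖coord hβ.isIntegral j x‖ ≤ R} := by
    ext x; simp [trap]
  rw [this]
  refine ((continuous_proj hβ.isIntegral).measurable T.measurableSet_X).inter ?_
  refine MeasurableSet.iInter fun j => MeasurableSet.iInter fun _ => ?_
  exact (isClosed_le (continuous_coord _ j).norm continuous_const).measurableSet

theorem lift_image_eq (hβ : IsPisotUnit β) {C : Set (Fin (deg β) → ℝ)} (hC : MapsTo (proj β) C T.X) :
    T.lift hβ '' C = ⋃ a ∈ T.A, branch hβ a '' (C ∩ proj β ⁻¹' T.piece a) := by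
  ext y
  simp only [mem_image, mem_iUnion]
  constructor
  · rintro ⟨x, hx, rfl⟩
    exact ⟨_, (T.digit_mem (hC hx)).1, x, ⟨hx, (T.digit_mem (hC hx)).2⟩, rfl⟩
  · rintro ⟨a, ha, x, ⟨hx, hxa⟩, rfl⟩
    exact ⟨x, hx, by rw [lift, T.digit_eq ha hxa]⟩

/-- Forward images stay Borel because `lift` consists of finitely many invertible affine maps on
Borel pieces. -/
theorem measurableSet_lift_image (hβ : IsPisotUnit β) {C : Set (Fin (deg β) → ℝ)} (hC : MapsTo (proj β) C T.X)
    (hm : MeasurableSet C) : MeasurableSet (T.lift hβ '' C) := by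
  rw [T.lift_image_eq hβ hC]
  refine Finset.measurableSet_biUnion _ fun a ha => ?_
  rw [MeasurableEquiv.measurableSet_image]
  exact hm.inter ((continuous_proj hβ.isIntegral).measurable (T.measurableSet_piece ha))

theorem measurableSet_iterate_image (hβ : IsPisotUnit β) (hA : ∀ a ∈ T.A, a ∈ QBeta β) {R : ℝ}
    (hR : T.IsTrapRadius R) (n : ℕ) : MeasurableSet ((T.lift hβ)^[n] '' T.trap hβ R) := by
  induction n with
  | zero => simpa using T.measurableSet_trap hβ R
  | succ n ih =>
    rw [Function.iterate_succ', image_comp]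
    refine T.measurableSet_lift_image hβ ?_ ih
    rintro _ ⟨x, hx, rfl⟩
    exact ((T.mapsTo_lift hβ hA hR).iterate n hx).1

/-! ### The set `X̂` -/

/-- The constant is the one for which the geometric series sums to exactly `R`, so that `ψ(u)` lands
in `trap R`. -/
theorem norm_Gam_mul_pow_le {R : ℝ} (hR : T.IsTrapRadius R) {a : ℝ} (ha : a ∈ T.A) {j : Emb β}
    (hj : j ≠ emb₁ β) (n : ℕ) :
    ‖Gam β j a * conj β j ^ n‖ ≤ (R * (1 - ‖conj β j‖)) * ‖conj β j‖ ^ n := by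
  rw [norm_mul, norm_pow]
  gcongr
  linarith [hR.2 a ha j hj]

theorem summable_Gam_mul_pow (hβ : IsPisotUnit β) {v : ℕ → ℝ} (hv : ∀ n, v n ∈ T.A) {j : Emb β} (hj : j ≠ emb₁ β) :
    Summable fun n : ℕ => Gam β j (v n) * conj β j ^ n := by
  obtain ⟨R, -, hR⟩ := T.exists_isTrapRadius hβ 0
  exact Summable.of_norm_bounded ((summable_geometric_of_lt_one (norm_nonneg _)
    (norm_conj_lt_one hβ hj)).mul_left _) fun n => T.norm_Gam_mul_pow_le hR (hv n) hj n

theorem coord_psi_of_mem (hβ : IsPisotUnit β) {u : ℤ → ℝ} (hu : u ∈ T.twoSided) {j : Emb β} (hj : j ≠ emb₁ β) :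
    coord hβ.isIntegral j (psi β u) = -∑' n : ℕ, Gam β j (u (-(n : ℤ))) * conj β j ^ n := by
  classical
  rw [coord_psi hβ.isIntegral fun j hj =>
    T.summable_Gam_mul_pow hβ (fun n => T.apply_mem_of_mem_twoSided hu _) hj, if_neg hj]

theorem proj_psi_of_orbit (hβ : IsPisotUnit β) {u : ℤ → ℝ} {x : ℤ → ℝ}
    (hx : ∀ k, x k ∈ T.X ∧ T.map (x k) = x (k + 1) ∧ u k = T.digit (x k)) :
    proj β (psi β u) = x 1 := by
  classical
  have hu : u ∈ T.twoSided := (T.mem_twoSided_iff hβ.one_lt).2 ⟨x, hx⟩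
  have h1 := coord_psi hβ.isIntegral (u := u) (fun j hj =>
    T.summable_Gam_mul_pow hβ (fun n => T.apply_mem_of_mem_twoSided hu _) hj) (emb₁ β)
  rw [if_pos rfl, ← ofReal_proj, Complex.ofReal_inj] at h1
  rw [h1, ← (T.hasSum_expansion hβ.one_lt (hx 1).1).tsum_eq]
  refine tsum_congr fun n => ?_
  have hit : ∀ n : ℕ, T.map^[n] (x 1) = x (n + 1) := by
    intro n
    induction n with
    | zero => simp
    | succ n ih => rw [Function.iterate_succ_apply', ih, (hx _).2.1]; push_cast; ring_nf
  rw [expansion, hit, (hx _).2.2]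

theorem proj_psi_mem (hβ : IsPisotUnit β) {u : ℤ → ℝ} (hu : u ∈ T.twoSided) :
    proj β (psi β u) ∈ T.X ∧ T.digit (proj β (psi β u)) = u 1 := by
  obtain ⟨x, hx⟩ := (T.mem_twoSided_iff hβ.one_lt).1 hu
  rw [T.proj_psi_of_orbit hβ hx]
  exact ⟨(hx 1).1, (hx 1).2.2.symm⟩

/-- `ψ` carries the shift to `lift`. In a contracting coordinate the shifted series has the digit
`u_1` as its new zeroth term, followed by `β_j` times the old series; along `v_1` the base point
advances by `T`. -/
theorem lift_psi (hβ : IsPisotUnit β) (hA : ∀ a ∈ T.A, a ∈ QBeta β) {u : ℤ → ℝ} (hu : u ∈ T.twoSided) :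
    T.lift hβ (psi β u) = psi β fun k => u (k + 1) := by
  refine coord_ext hβ.isIntegral fun j => ?_
  have hu' := T.twoSided_shift hu 1
  by_cases hj : j = emb₁ β
  · obtain ⟨x, hx⟩ := (T.mem_twoSided_iff hβ.one_lt).1 hu
    have h1 := T.proj_psi_of_orbit hβ hx
    have h2 := T.proj_psi_of_orbit hβ (u := fun k => u (k + 1)) (x := fun k => x (k + 1))
      fun k => hx (k + 1)
    rw [hj, ← ofReal_proj, ← ofReal_proj, T.proj_lift hβ hA (h1 ▸ (hx 1).1), h1, h2, (hx 1).2.1]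
  · rw [coord_lift, (T.proj_psi_mem hβ hu).2, T.coord_psi_of_mem hβ hu hj,
      T.coord_psi_of_mem hβ hu' hj, (T.summable_Gam_mul_pow hβ
        (fun n : ℕ => T.apply_mem_of_mem_twoSided hu' (-(n : ℤ))) hj).tsum_eq_zero_add,
      mul_neg, ← tsum_mul_left]
    simp only [Nat.cast_zero, neg_zero, zero_add, pow_zero, mul_one, neg_add]
    rw [sub_eq_add_neg, add_comm]
    congr 2
    refine tsum_congr fun n => ?_
    rw [show (-((n + 1 : ℕ) : ℤ) + 1) = -(n : ℤ) by push_cast; ring]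
    ring

theorem psi_mem_trap (hβ : IsPisotUnit β) {R : ℝ} (hR : T.IsTrapRadius R) {u : ℤ → ℝ} (hu : u ∈ T.twoSided) :
    psi β u ∈ T.trap hβ R := by
  refine ⟨(T.proj_psi_mem hβ hu).1, fun j hj => ?_⟩
  have h1 := norm_conj_lt_one hβ hj
  rw [T.coord_psi_of_mem hβ hu hj, norm_neg]
  have h2 := (hasSum_geometric_of_lt_one (norm_nonneg _) h1).mul_left (R * (1 - ‖conj β j‖))
  rw [mul_assoc, mul_inv_cancel₀ (sub_pos.2 h1).ne', mul_one] at h2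
  exact tsum_of_norm_bounded h2 fun n =>
    T.norm_Gam_mul_pow_le hR (T.apply_mem_of_mem_twoSided hu _) hj n

/-- Each step gives `c_n = β_j c_{n+1} - Γ_j(a_{n+1})`. Iterating leaves the remainder `β_j^n c_n`,
which tends to `0` since the orbit stays in the trap. -/
theorem coord_backward_orbit (hβ : IsPisotUnit β) {R : ℝ} {o : ℕ → Fin (deg β) → ℝ}
    (ho : ∀ n, o n ∈ T.trap hβ R ∧ T.lift hβ (o (n + 1)) = o n) {j : Emb β} (hj : j ≠ emb₁ β) :
    coord hβ.isIntegral j (o 0) =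
      -∑' n, Gam β j (T.digit (proj β (o (n + 1)))) * conj β j ^ n := by
  have hs := T.summable_Gam_mul_pow hβ (v := fun n => T.digit (proj β (o (n + 1))))
    (fun n => (T.digit_mem (ho (n + 1)).1.1).1) hj
  have hsum : ∀ n, ∑ i ∈ Finset.range n,
      Gam β j (T.digit (proj β (o (i + 1)))) * conj β j ^ i =
      conj β j ^ n * coord hβ.isIntegral j (o n) - coord hβ.isIntegral j (o 0) := by
    intro n
    induction n with
    | zero => simp
    | succ n ih =>
      have h1 := T.coord_lift hβ j (o (n + 1))
      rw [(ho n).2] at h1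
      rw [Finset.sum_range_succ, ih, h1]
      ring
  have hz : Filter.Tendsto (fun n => conj β j ^ n * coord hβ.isIntegral j (o n))
      Filter.atTop (nhds 0) := by
    refine squeeze_zero_norm (a := fun n => ‖conj β j‖ ^ n * R) (fun n => ?_) ?_
    · rw [norm_mul, norm_pow]
      gcongr
      exact (ho n).1.2 j hj
    · simpa using (tendsto_pow_atTop_nhds_zero_of_lt_one (norm_nonneg _)
        (norm_conj_lt_one hβ hj)).mul_const R
  have h3 : HasSum (fun n => Gam β j (T.digit (proj β (o (n + 1)))) * conj β j ^ n)
      (-coord hβ.isIntegral j (o 0)) := by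
    rw [hs.hasSum_iff_tendsto_nat]
    simp only [hsum]
    simpa using hz.sub_const (coord hβ.isIntegral j (o 0))
  rw [h3.tsum_eq, neg_neg]

/-- The contracting coordinates of a point are determined by the digits of its backward orbit, and
its `v_1`-coordinate by its forward digits. Together these digits form the two-sided sequence whose
image under `ψ` is the point. -/
theorem mem_Xhat_iff (hβ : IsPisotUnit β) (hA : ∀ a ∈ T.A, a ∈ QBeta β) {R : ℝ} (hR : T.IsTrapRadius R)
    {x : Fin (deg β) → ℝ} : x ∈ T.Xhat ↔
      ∃ o : ℕ → Fin (deg β) → ℝ, o 0 = x ∧ ∀ n, o n ∈ T.trap hβ R ∧ T.lift hβ (o (n + 1)) = o n := by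
  constructor
  · rintro ⟨u, hu, rfl⟩
    have hs : ∀ n : ℕ, (fun k => u (k + -n)) ∈ T.twoSided := fun n => T.twoSided_shift hu _
    refine ⟨fun n => psi β fun k => u (k + -n), by simp,
      fun n => ⟨T.psi_mem_trap hβ hR (hs n), ?_⟩⟩
    rw [T.lift_psi hβ hA (hs (n + 1))]
    congr 1
    ext k
    congr 1
    push_cast
    ring
  · rintro ⟨o, rfl, ho⟩
    -- The projected two-sided orbit, with the present at index `1`, as `ψ` treats `u_1` as the next
    -- digit: `y 1 = π(o 0)` and `y (-n) = π(o (n + 1))`.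
    set y : ℤ → ℝ := fun k => if 1 ≤ k then T.map^[(k - 1).toNat] (proj β (o 0))
      else proj β (o (1 - k).toNat) with hy
    have hy' : ∀ n : ℕ, y (-n) = proj β (o (n + 1)) := by
      intro n
      simp only [hy]
      rw [if_neg (by omega)]
      congr 2
      omega
    have hyx : ∀ k, y k ∈ T.X ∧ T.map (y k) = y (k + 1) ∧ T.digit (y k) = T.digit (y k) := by
      intro k
      refine ⟨?_, ?_, rfl⟩
      · simp only [hy]
        split_ifs
        · exact T.mapsTo_map.iterate _ (ho 0).1.1
        · exact (ho _).1.1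
      · rcases lt_or_ge 0 k with hk | hk
        · obtain ⟨n, rfl⟩ : ∃ n : ℕ, k = n + 1 := ⟨(k - 1).toNat, by omega⟩
          simp only [hy]
          rw [if_pos (by omega), if_pos (by omega),
            ← Function.iterate_succ_apply' T.map]
          congr 1
          omega
        · obtain ⟨n, rfl⟩ : ∃ n : ℕ, k = -n := ⟨(-k).toNat, by omega⟩
          rw [hy', ← T.proj_lift hβ hA (ho _).1.1, (ho n).2]
          cases n with
          | zero => simp [hy]
          | succ n => rw [← hy' n]; congr 1; push_cast; ring
    have hu : (fun k => T.digit (y k)) ∈ T.twoSided :=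
      (T.mem_twoSided_iff hβ.one_lt).2 ⟨y, hyx⟩
    refine ⟨_, hu, coord_ext hβ.isIntegral fun j => ?_⟩
    by_cases hj : j = emb₁ β
    · rw [hj, ← ofReal_proj, ← ofReal_proj, T.proj_psi_of_orbit hβ hyx]
      simp [hy]
    · rw [T.coord_psi_of_mem hβ hu hj, T.coord_backward_orbit hβ ho hj]
      simp only [hy']

theorem Xhat_eq_iInter (hβ : IsPisotUnit β) (hA : ∀ a ∈ T.A, a ∈ QBeta β) {R : ℝ} (hR : T.IsTrapRadius R) :
    T.Xhat = ⋂ n, (T.lift hβ)^[n] '' T.trap hβ R := by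
  ext x
  refine ⟨fun hx => ?_, fun hx => ?_⟩
  · obtain ⟨o, rfl, ho⟩ := (T.mem_Xhat_iff hβ hA hR).1 hx
    refine mem_iInter.2 fun n => ⟨o n, (ho n).1, ?_⟩
    induction n with
    | zero => rfl
    | succ n ih => rw [Function.iterate_succ_apply, (ho n).2, ih]
  · exact (T.mem_Xhat_iff hβ hA hR).2
      (exists_backward_orbit (T.mapsTo_lift hβ hA hR) (T.finite_fiber hβ R) hx)

theorem lift_image_Xhat (hβ : IsPisotUnit β) (hA : ∀ a ∈ T.A, a ∈ QBeta β) : T.lift hβ '' T.Xhat = T.Xhat := by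
  ext x
  constructor
  · rintro ⟨_, ⟨u, hu, rfl⟩, rfl⟩
    rw [T.lift_psi hβ hA hu]
    exact ⟨_, T.twoSided_shift hu 1, rfl⟩
  · rintro ⟨u, hu, rfl⟩
    refine ⟨_, ⟨_, T.twoSided_shift hu (-1), rfl⟩, ?_⟩
    rw [T.lift_psi hβ hA (T.twoSided_shift hu (-1))]
    simp

theorem proj_mem_of_mem_Xhat (hβ : IsPisotUnit β) {x : Fin (deg β) → ℝ} (hx : x ∈ T.Xhat) : proj β x ∈ T.X := by
  obtain ⟨u, hu, rfl⟩ := hx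
  exact (T.proj_psi_mem hβ hu).1

theorem mem_XhatPiece_iff (hβ : IsPisotUnit β) {x : Fin (deg β) → ℝ} {a : ℝ} :
    x ∈ T.XhatPiece a ↔ x ∈ T.Xhat ∧ T.digit (proj β x) = a := by
  constructor
  · rintro ⟨u, ⟨hu, hua⟩, rfl⟩
    exact ⟨⟨u, hu, rfl⟩, (T.proj_psi_mem hβ hu).2.trans hua⟩
  · rintro ⟨⟨u, hu, rfl⟩, hua⟩
    exact ⟨u, ⟨hu, (T.proj_psi_mem hβ hu).2.symm.trans hua⟩, rfl⟩

theorem hatDigit_eq (hβ : IsPisotUnit β) {x : Fin (deg β) → ℝ} (hx : x ∈ T.Xhat) :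
    T.hatDigit x = T.digit (proj β x) := by
  have h : ∃ a ∈ T.A, x ∈ T.XhatPiece a :=
    ⟨_, (T.digit_mem (T.proj_mem_of_mem_Xhat hβ hx)).1, (T.mem_XhatPiece_iff hβ).2 ⟨hx, rfl⟩⟩
  rw [hatDigit, dif_pos h]
  exact ((T.mem_XhatPiece_iff hβ).1 h.choose_spec.2).2.symm

theorem That_eq_lift (hβ : IsPisotUnit β) {x : Fin (deg β) → ℝ} (hx : x ∈ T.Xhat) : T.That x = T.lift hβ x := by
  rw [That, T.hatDigit_eq hβ hx]; rfl

/-! ### Measurability and volume of `X̂` -/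

theorem measurableSet_Xhat (hβ : IsPisotUnit β) (hA : ∀ a ∈ T.A, a ∈ QBeta β) : MeasurableSet T.Xhat := by
  obtain ⟨R, -, hR⟩ := T.exists_isTrapRadius hβ 0
  rw [T.Xhat_eq_iInter hβ hA hR]
  exact MeasurableSet.iInter fun n => T.measurableSet_iterate_image hβ hA hR n

theorem Xhat_subset_trap (hβ : IsPisotUnit β) (hA : ∀ a ∈ T.A, a ∈ QBeta β) {R : ℝ} (hR : T.IsTrapRadius R) :
    T.Xhat ⊆ T.trap hβ R := by
  rw [T.Xhat_eq_iInter hβ hA hR]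
  intro x hx
  simpa using mem_iInter.1 hx 0

theorem volume_Xhat_lt_top (hβ : IsPisotUnit β) (hA : ∀ a ∈ T.A, a ∈ QBeta β) : volume T.Xhat < ∞ := by
  obtain ⟨R, -, hR⟩ := T.exists_isTrapRadius hβ 0
  exact ((T.isBounded_trap hβ R).subset (T.Xhat_subset_trap hβ hA hR)).measure_lt_top

/-- Modulo the lattice, `lift` is the automorphism `M_β`. So every coset meets each `lift^n (trap
R)`, and finiteness of the coset inside the trap passes this to the intersection `X̂`. -/
theorem exists_lattice_add_mem_Xhat (hβ : IsPisotUnit β) (hA : ∀ a ∈ T.A, a ∈ QBeta β) :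
    ∃ q : ℕ, 0 < q ∧ ∀ p : Fin (deg β) → ℝ, ∃ y ∈ lattice (deg β) q, p + y ∈ T.Xhat := by
  obtain ⟨q, hq, hqA⟩ := exists_forall_Psi_mem_lattice hβ.isIntegral T.A hA
  obtain ⟨l, r, hlr, hX⟩ := T.exists_Ico_subset
  obtain ⟨R₀, hR₀⟩ := exists_lattice_add_mem hβ q hlr
  obtain ⟨R, hR₀R, hR⟩ := T.exists_isTrapRadius hβ R₀
  have hmaps := T.mapsTo_lift hβ hA hR
  have hmat : ∀ {y}, y ∈ lattice (deg β) q → companion β *ᵥ y ∈ lattice (deg β) q := fun hy => by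
    rw [← map_companionInt]; exact map_mulVec_mem_lattice _ hy
  have hit : ∀ z ∈ T.trap hβ R, ∀ n,
      (T.lift hβ)^[n] z - companion β ^ n *ᵥ z ∈ lattice (deg β) q := by
    intro z hz n
    induction n with
    | zero => simp
    | succ n ih =>
      have h1 := (T.digit_mem (hmaps.iterate n hz).1).1
      rw [Function.iterate_succ_apply', lift, branch_apply, pow_succ', ← Matrix.mulVec_mulVec,
        sub_right_comm, ← Matrix.mulVec_sub]
      exact sub_mem (hmat ih) (hqA _ h1)
  refine ⟨q, hq, fun p => ?_⟩
  have hfin : {y | y ∈ lattice (deg β) q ∧ p + y ∈ T.trap hβ R}.Finite := by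
    refine (finite_lattice_inter hq (s := (fun y => p + y) ⁻¹' T.trap hβ R) ?_).subset
      fun y hy => hy
    have := ((T.isBounded_trap hβ R).vadd (-p))
    refine this.subset fun y hy => ⟨p + y, hy, by simp⟩
  obtain ⟨y, hy, hy'⟩ := exists_forall_of_antitone_of_finite hfin
    (t := fun n => (fun y => p + y) ⁻¹' ((T.lift hβ)^[n] '' T.trap hβ R))
    (fun m n hmn => preimage_mono (antitone_iterate_image hmaps hmn)) (fun n => by
      have hu : IsUnit (companion β ^ n) := by
        refine IsUnit.pow n ((Matrix.isUnit_iff_isUnit_det _).2 (isUnit_iff_ne_zero.2 ?_))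
        rw [← abs_pos, abs_det_companion hβ]; exact one_pos
      -- Write `p = M_β^n w` and move `w` into the trap by a lattice vector `y`; then `lift^n (w +
      -- y)` lies in `p + L`.
      obtain ⟨w, rfl⟩ := Matrix.mulVec_surjective_iff_isUnit.2 hu p
      obtain ⟨y, hy, hy1, hy2⟩ := hR₀ w
      have hwy : w + y ∈ T.trap hβ R := ⟨hX hy1, fun j hj => (hy2 j hj).trans hR₀R⟩
      have hyn : companion β ^ n *ᵥ y ∈ lattice (deg β) q := by
        rw [← map_companionInt, ← map_pow]; exact map_mulVec_mem_lattice _ hy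
      have hsum := add_mem (hit _ hwy n) hyn
      have he : companion β ^ n *ᵥ w + ((T.lift hβ)^[n] (w + y) - companion β ^ n *ᵥ (w + y) +
          companion β ^ n *ᵥ y) = (T.lift hβ)^[n] (w + y) := by
        rw [Matrix.mulVec_add]; abel
      refine ⟨_, ⟨hsum, ?_⟩, w + y, hwy, he.symm⟩
      rw [he]
      exact hmaps.iterate n hwy)
  refine ⟨y, hy.1, ?_⟩
  rw [T.Xhat_eq_iInter hβ hA hR]
  exact mem_iInter.2 hy'

/-- If `X̂` were null, its countably many lattice translates could not cover the space. -/
theorem volume_Xhat_pos (hβ : IsPisotUnit β) (hA : ∀ a ∈ T.A, a ∈ QBeta β) : 0 < volume T.Xhat := by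
  obtain ⟨q, hq0, hq⟩ := T.exists_lattice_add_mem_Xhat hβ hA
  rw [pos_iff_ne_zero]
  intro h0
  have hcov : (univ : Set (Fin (deg β) → ℝ)) ⊆
      ⋃ y ∈ lattice (deg β) q, (fun p => p + y) ⁻¹' T.Xhat := fun p _ => by
    obtain ⟨y, hy, hpy⟩ := hq p
    exact mem_biUnion (show y ∈ (lattice (deg β) q : Set _) from hy) hpy
  have hnull : volume (⋃ y ∈ lattice (deg β) q, (fun p => p + y) ⁻¹' T.Xhat) = 0 := by
    refine (measure_biUnion_null_iff (countable_lattice hq0)).2 fun y _ => ?_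
    rw [measure_preimage_add_right, h0]
  exact (Measure.measure_univ_pos.2 (NeZero.ne volume)).ne' (measure_mono_null hcov hnull)

end RightContBetaTransformation

/-! ### Grand orbits of null sets -/

/-- The points of `Y` whose forward orbit meets the forward orbit of a point of `D`. -/
def grandOrbit {α : Type*} (Y : Set α) (S : α → α) (D : Set α) : Set α :=
  {y | y ∈ Y ∧ ∃ m n : ℕ, ∃ e ∈ D, S^[m] y = S^[n] e}

theorem subset_grandOrbit {α : Type*} {Y D : Set α} {S : α → α} (hD : D ⊆ Y) :
    D ⊆ grandOrbit Y S D := fun e he => ⟨hD he, 0, 0, e, he, rfl⟩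

/-- Invariance in both directions lets `S` restrict to the complement of the grand orbit without
losing surjectivity. -/
theorem mem_grandOrbit_iff {α : Type*} {Y D : Set α} {S : α → α} (hS : MapsTo S Y Y) {y : α}
    (hy : y ∈ Y) : S y ∈ grandOrbit Y S D ↔ y ∈ grandOrbit Y S D := by
  constructor
  · rintro ⟨-, m, n, e, he, h⟩
    exact ⟨hy, m + 1, n, e, he, h⟩
  · rintro ⟨-, m, n, e, he, h⟩
    refine ⟨hS hy, m, n + 1, e, he, ?_⟩
    rw [← Function.iterate_succ_apply, Function.iterate_succ_apply', h,
      Function.iterate_succ_apply']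

theorem measure_grandOrbit {α : Type*} [MeasurableSpace α] {ν : Measure α} {Y D : Set α}
    {S : α → α} (hS : MapsTo S Y Y) (himage : ∀ C ⊆ Y, ν C = 0 → ν (S '' C) = 0)
    (hpre : ∀ C ⊆ Y, ν C = 0 → ν (Y ∩ S ⁻¹' C) = 0) (hD : D ⊆ Y) (h0 : ν D = 0) :
    ν (grandOrbit Y S D) = 0 := by
  have h1 : ∀ n : ℕ, S^[n] '' D ⊆ Y ∧ ν (S^[n] '' D) = 0 := by
    intro n
    induction n with
    | zero => simpa using ⟨hD, h0⟩
    | succ n ih =>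
      rw [Function.iterate_succ', image_comp]
      exact ⟨(hS.mono_left ih.1).image_subset, himage _ ih.1 ih.2⟩
  have h2 : ∀ C ⊆ Y, ν C = 0 → ∀ m : ℕ, ν (Y ∩ S^[m] ⁻¹' C) = 0 := by
    intro C hC hC0 m
    induction m with
    | zero => exact measure_mono_null inter_subset_right hC0
    | succ m ih =>
      refine measure_mono_null ?_ (hpre _ inter_subset_left ih)
      rintro x ⟨hx, hxC⟩
      exact ⟨hx, hS hx, hxC⟩
  have : grandOrbit Y S D ⊆ ⋃ (m : ℕ) (n : ℕ), Y ∩ S^[m] ⁻¹' (S^[n] '' D) := by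
    rintro y ⟨hy, m, n, e, he, h⟩
    exact mem_iUnion₂.2 ⟨m, n, hy, e, he, h.symm⟩
  refine measure_mono_null this (measure_iUnion_null fun m => measure_iUnion_null fun n => ?_)
  exact h2 _ (h1 n).1 (h1 n).2 m

/-- Used to control projections: the continuous image of a compact set is measurable, unlike that of
a general measurable set. -/
theorem exists_isCompact_seq_subset {α : Type*} [MeasurableSpace α] [TopologicalSpace α]
    [OpensMeasurableSpace α] [T2Space α] {ν : Measure α} [ν.InnerRegularCompactLTTop] {V : Set α}
    (hV : NullMeasurableSet V ν) (hfin : ν V ≠ ∞) :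
    ∃ K : ℕ → Set α, (∀ n, IsCompact (K n)) ∧ (∀ n, K n ⊆ V) ∧ ν (V \ ⋃ n, K n) = 0 := by
  obtain ⟨W, hWV, hW, hae⟩ := hV.exists_measurable_subset_ae_eq
  have h1 : ∀ n : ℕ, ∃ K ⊆ W, IsCompact K ∧ ν (W \ K) < ((n : ℝ≥0∞) + 1)⁻¹ := fun n =>
    hW.exists_isCompact_sdiff_lt (measure_mono hWV |>.trans_lt hfin.lt_top).ne (by simp)
  choose K hKW hK hlt using h1
  refine ⟨K, hK, fun n => (hKW n).trans hWV, ?_⟩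
  have h2 : ν (W \ ⋃ n, K n) = 0 := by
    by_contra hne
    obtain ⟨n, hn⟩ := ENNReal.exists_inv_nat_lt hne
    refine absurd ((measure_mono (sdiff_subset_sdiff_right (subset_iUnion K n))).trans_lt
      ((hlt n).trans_le ?_)) hn.not_gt
    exact ENNReal.inv_le_inv.2 le_self_add
  refine measure_mono_null (t := (V \ W) ∪ (W \ ⋃ n, K n)) (fun x hx => ?_)
    (measure_union_null (ae_le_set.1 hae.symm.le) h2)
  by_cases hxW : x ∈ W
  · exact Or.inr ⟨hxW, hx.2⟩
  · exact Or.inl ⟨hx.1, hxW⟩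

namespace RightContBetaTransformation

variable (T : RightContBetaTransformation β)

/-! ### Measurability of `T` -/

theorem measurable_digit : Measurable T.digit := by
  classical
  have : T.digit = fun x => ∑ a ∈ T.A, (T.piece a).indicator (fun _ => a) x := by
    ext x
    by_cases hx : x ∈ T.X
    · obtain ⟨h1, h2⟩ := T.digit_mem hx
      rw [Finset.sum_eq_single_of_mem _ h1, indicator_of_mem h2]
      intro b hb hne
      refine indicator_of_notMem (fun hxb => hne (T.digit_eq hb hxb).symm) _
    · have h : ¬ ∃ a ∈ T.A, x ∈ T.piece a := by simpa [X] using hx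
      rw [digit, dif_neg h, Finset.sum_eq_zero]
      exact fun a ha => indicator_of_notMem (fun hxa => h ⟨a, ha, hxa⟩) _
  rw [this]
  exact Finset.measurable_sum _ fun a ha => measurable_const.indicator (T.measurableSet_piece ha)

theorem measurable_map : Measurable T.map :=
  (measurable_const.mul measurable_id).sub T.measurable_digit

theorem quasiMeasurePreserving_mul_sub (hβ : β ≠ 0) (a : ℝ) :
    Measure.QuasiMeasurePreserving (fun x : ℝ => β * x - a) volume volume :=
  (measurePreserving_sub_right volume a).quasiMeasurePreserving.comp
    (Measure.quasiMeasurePreserving_smul volume hβ)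

theorem nullMeasurableSet_preimage_map (hβ : β ≠ 0) {B : Set ℝ} (hB : NullMeasurableSet B) :
    NullMeasurableSet (T.X ∩ T.map ⁻¹' B) := by
  have : T.X ∩ T.map ⁻¹' B = ⋃ a ∈ T.A, T.piece a ∩ (fun x => β * x - a) ⁻¹' B := by
    ext x
    simp only [mem_inter_iff, mem_iUnion, mem_preimage]
    constructor
    · rintro ⟨hx, hxB⟩
      exact ⟨_, (T.digit_mem hx).1, (T.digit_mem hx).2, hxB⟩
    · rintro ⟨a, ha, hxa, hxB⟩
      exact ⟨T.piece_subset ha hxa, by rwa [map, T.digit_eq ha hxa]⟩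
  rw [this]
  exact Finset.nullMeasurableSet_biUnion _ fun a ha =>
    (T.measurableSet_piece ha).nullMeasurableSet.inter
      (hB.preimage (quasiMeasurePreserving_mul_sub hβ a))

/-! ### `T̂` preserves Lebesgue measure -/

theorem That_image_eq (hβ : IsPisotUnit β) {C : Set (Fin (deg β) → ℝ)} (hC : C ⊆ T.Xhat) :
    T.That '' C = ⋃ a ∈ T.A, branch hβ a '' (C ∩ proj β ⁻¹' T.piece a) := by
  rw [image_congr fun x hx => T.That_eq_lift hβ (hC hx),
    T.lift_image_eq hβ fun x hx => T.proj_mem_of_mem_Xhat hβ (hC hx)]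

theorem That_image_Xhat (hβ : IsPisotUnit β) (hA : ∀ a ∈ T.A, a ∈ QBeta β) :
    T.That '' T.Xhat = T.Xhat := by
  rw [image_congr fun x hx => T.That_eq_lift hβ hx, T.lift_image_Xhat hβ hA]

theorem mapsTo_That (hβ : IsPisotUnit β) (hA : ∀ a ∈ T.A, a ∈ QBeta β) :
    MapsTo T.That T.Xhat T.Xhat := fun x hx => by
  rw [← T.That_image_Xhat hβ hA]; exact mem_image_of_mem _ hx

theorem proj_That (hβ : IsPisotUnit β) (hA : ∀ a ∈ T.A, a ∈ QBeta β) {x : Fin (deg β) → ℝ}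
    (hx : x ∈ T.Xhat) : proj β (T.That x) = T.map (proj β x) := by
  rw [T.That_eq_lift hβ hx, T.proj_lift hβ hA (T.proj_mem_of_mem_Xhat hβ hx)]

theorem measurableSet_proj_preimage_piece (hβ : IsPisotUnit β) {a : ℝ} (ha : a ∈ T.A) :
    MeasurableSet (proj β ⁻¹' T.piece a) :=
  (continuous_proj hβ.isIntegral).measurable (T.measurableSet_piece ha)

theorem image_branch_eq (hβ : IsPisotUnit β) (a : ℝ) (C : Set (Fin (deg β) → ℝ)) :
    branch hβ a '' C = (branch hβ a).symm ⁻¹' C := (branch hβ a).image_eq_preimage_symm C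

theorem nullMeasurableSet_branch_image (hβ : IsPisotUnit β) (a : ℝ) {C : Set (Fin (deg β) → ℝ)}
    (hC : NullMeasurableSet C) : NullMeasurableSet (branch hβ a '' C) := by
  rw [image_branch_eq]
  exact hC.preimage ((measurePreserving_branch hβ a).symm _).quasiMeasurePreserving

theorem volume_branch_image (hβ : IsPisotUnit β) (a : ℝ) (C : Set (Fin (deg β) → ℝ)) :
    volume (branch hβ a '' C) = volume C := by
  rw [image_branch_eq, ((measurePreserving_branch hβ a).symm _).measure_preimage_equiv]

theorem nullMeasurableSet_That_image (hβ : IsPisotUnit β) {C : Set (Fin (deg β) → ℝ)}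
    (hC : C ⊆ T.Xhat) (hm : NullMeasurableSet C) : NullMeasurableSet (T.That '' C) := by
  rw [T.That_image_eq hβ hC]
  exact Finset.nullMeasurableSet_biUnion _ fun a ha => nullMeasurableSet_branch_image hβ a
    (hm.inter (T.measurableSet_proj_preimage_piece hβ ha).nullMeasurableSet)

/-- The branches preserve volume and act on disjoint pieces; only overlaps of their images can lose
measure. -/
theorem volume_That_image_le (hβ : IsPisotUnit β) {C : Set (Fin (deg β) → ℝ)}
    (hC : C ⊆ T.Xhat) (hm : NullMeasurableSet C) : volume (T.That '' C) ≤ volume C := by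
  rw [T.That_image_eq hβ hC]
  refine (measure_biUnion_finset_le _ _).trans ?_
  simp only [volume_branch_image]
  rw [← measure_biUnion_finset₀]
  · exact measure_mono (iUnion₂_subset fun a _ => inter_subset_left)
  · intro a ha b hb hne
    refine (Disjoint.aedisjoint ?_)
    refine Disjoint.mono inter_subset_right inter_subset_right ?_
    exact (T.pairwiseDisjoint ha hb hne).preimage _
  · exact fun a ha => hm.inter (T.measurableSet_proj_preimage_piece hβ ha).nullMeasurableSet

theorem nullMeasurableSet_preimage_That (hβ : IsPisotUnit β) (hA : ∀ a ∈ T.A, a ∈ QBeta β)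
    {B : Set (Fin (deg β) → ℝ)} (hB : NullMeasurableSet B) :
    NullMeasurableSet (T.Xhat ∩ T.That ⁻¹' B) := by
  have : T.Xhat ∩ T.That ⁻¹' B =
      T.Xhat ∩ ⋃ a ∈ T.A, proj β ⁻¹' T.piece a ∩ branch hβ a ⁻¹' B := by
    ext x
    simp only [mem_inter_iff, mem_iUnion, mem_preimage]
    refine and_congr_right fun hx => ?_
    rw [T.That_eq_lift hβ hx]
    constructor
    · intro hxB
      have := T.digit_mem (T.proj_mem_of_mem_Xhat hβ hx)
      exact ⟨_, this.1, this.2, hxB⟩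
    · rintro ⟨a, ha, hxa, hxB⟩
      rwa [lift, T.digit_eq ha hxa]
  rw [this]
  refine (T.measurableSet_Xhat hβ hA).nullMeasurableSet.inter ?_
  exact Finset.nullMeasurableSet_biUnion _ fun a ha =>
    (T.measurableSet_proj_preimage_piece hβ ha).nullMeasurableSet.inter
      (hB.preimage (measurePreserving_branch hβ a).quasiMeasurePreserving)

/-- Surjectivity of `T̂` makes `B` part of the image of its preimage, and images do not gain volume.
-/
theorem volume_le_volume_preimage_That (hβ : IsPisotUnit β) (hA : ∀ a ∈ T.A, a ∈ QBeta β)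
    {B : Set (Fin (deg β) → ℝ)} (hBX : B ⊆ T.Xhat) (hB : NullMeasurableSet B) :
    volume B ≤ volume (T.Xhat ∩ T.That ⁻¹' B) := by
  refine le_trans (measure_mono ?_) (T.volume_That_image_le hβ inter_subset_left
    (T.nullMeasurableSet_preimage_That hβ hA hB))
  intro y hy
  obtain ⟨x, hx, rfl⟩ := (T.That_image_Xhat hβ hA).symm ▸ hBX hy
  exact ⟨x, ⟨hx, hy⟩, rfl⟩

/-- The inequality for `B` and the one for `X̂ \ B` add up to the same finite total, so both are
equalities. -/
theorem volume_preimage_That (hβ : IsPisotUnit β) (hA : ∀ a ∈ T.A, a ∈ QBeta β)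
    {B : Set (Fin (deg β) → ℝ)} (hBX : B ⊆ T.Xhat) (hB : NullMeasurableSet B) :
    volume (T.Xhat ∩ T.That ⁻¹' B) = volume B := by
  have hX := (T.measurableSet_Xhat hβ hA).nullMeasurableSet (μ := volume)
  have hfin := T.volume_Xhat_lt_top hβ hA
  have h1 := T.volume_le_volume_preimage_That hβ hA hBX hB
  have h2 := T.volume_le_volume_preimage_That hβ hA (sdiff_subset (s := T.Xhat) (t := B))
    (hX.diff hB)
  have h3 : T.Xhat ∩ T.That ⁻¹' (T.Xhat \ B) = T.Xhat \ (T.Xhat ∩ T.That ⁻¹' B) := by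
    ext x
    simp only [mem_inter_iff, mem_preimage, mem_sdiff, not_and]
    exact ⟨fun h => ⟨h.1, fun _ => h.2.2⟩,
      fun h => ⟨h.1, T.mapsTo_That hβ hA h.1, h.2 h.1⟩⟩
  rw [h3] at h2
  have hsub : T.Xhat ∩ T.That ⁻¹' B ⊆ T.Xhat := inter_subset_left
  rw [measure_sdiff hBX hB (measure_mono hBX |>.trans_lt hfin).ne,
    measure_sdiff hsub (T.nullMeasurableSet_preimage_That hβ hA hB)
      (measure_mono hsub |>.trans_lt hfin).ne] at h2
  refine le_antisymm ?_ h1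
  exact (ENNReal.sub_le_sub_iff_left (measure_mono hsub) hfin.ne).1 h2

/-- The points of `X̂` with more than one preimage. -/
def overlap : Set (Fin (deg β) → ℝ) :=
  {y | ∃ x ∈ T.Xhat, ∃ x' ∈ T.Xhat, x ≠ x' ∧ T.That x = y ∧ T.That x' = y}

theorem overlap_subset (hβ : IsPisotUnit β) (hA : ∀ a ∈ T.A, a ∈ QBeta β) :
    T.overlap ⊆ T.Xhat := by
  rintro _ ⟨x, hx, -, -, -, rfl, -⟩
  exact T.mapsTo_That hβ hA hx

/-- The overlap `V` has two disjoint preimages, each of volume at least that of `V`. Invariance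
gives `2 λ(V) ≤ λ(V) < ∞`. -/
theorem volume_branch_image_inter (hβ : IsPisotUnit β) (hA : ∀ a ∈ T.A, a ∈ QBeta β) {a b : ℝ}
    (ha : a ∈ T.A) (hb : b ∈ T.A) (hab : a ≠ b) :
    volume (branch hβ a '' (T.Xhat ∩ proj β ⁻¹' T.piece a) ∩
      branch hβ b '' (T.Xhat ∩ proj β ⁻¹' T.piece b)) = 0 := by
  set V := branch hβ a '' (T.Xhat ∩ proj β ⁻¹' T.piece a) ∩
    branch hβ b '' (T.Xhat ∩ proj β ⁻¹' T.piece b) with hV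
  have hX := (T.measurableSet_Xhat hβ hA)
  have hVm : MeasurableSet V := by
    refine MeasurableSet.inter ?_ ?_ <;> rw [MeasurableEquiv.measurableSet_image]
    · exact hX.inter (T.measurableSet_proj_preimage_piece hβ ha)
    · exact hX.inter (T.measurableSet_proj_preimage_piece hβ hb)
  have hbr : ∀ {c}, c ∈ T.A → ∀ x ∈ T.Xhat ∩ proj β ⁻¹' T.piece c, T.That x = branch hβ c x :=
    fun hc x hx => by rw [T.That_eq_lift hβ hx.1, lift, T.digit_eq hc hx.2]
  have hVX : V ⊆ T.Xhat := by
    rintro _ ⟨⟨x, hx, rfl⟩, -⟩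
    rw [← hbr ha x hx]
    exact T.mapsTo_That hβ hA hx.1
  have hvol : ∀ c, V ⊆ branch hβ c '' (T.Xhat ∩ proj β ⁻¹' T.piece c) →
      volume V ≤ volume ((T.Xhat ∩ proj β ⁻¹' T.piece c) ∩ branch hβ c ⁻¹' V) := by
    intro c hVc
    refine le_trans (measure_mono fun y hy => ?_) (volume_branch_image hβ c _).le
    obtain ⟨x, hx, rfl⟩ := hVc hy
    exact ⟨x, ⟨hx, hy⟩, rfl⟩
  have hdisj : Disjoint ((T.Xhat ∩ proj β ⁻¹' T.piece a) ∩ branch hβ a ⁻¹' V)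
      ((T.Xhat ∩ proj β ⁻¹' T.piece b) ∩ branch hβ b ⁻¹' V) := by
    refine Disjoint.mono (inter_subset_left.trans inter_subset_right)
      (inter_subset_left.trans inter_subset_right) ?_
    exact (T.pairwiseDisjoint ha hb hab).preimage _
  have hsum : volume V + volume V ≤ volume V := by
    calc volume V + volume V ≤ _ := add_le_add (hvol a inter_subset_left) (hvol b inter_subset_right)
      _ = volume (((T.Xhat ∩ proj β ⁻¹' T.piece a) ∩ branch hβ a ⁻¹' V) ∪
          ((T.Xhat ∩ proj β ⁻¹' T.piece b) ∩ branch hβ b ⁻¹' V)) := by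
          rw [measure_union hdisj ((hX.inter (T.measurableSet_proj_preimage_piece hβ hb)).inter
            ((branch hβ b).measurable hVm))]
      _ ≤ volume (T.Xhat ∩ T.That ⁻¹' V) := by
          refine measure_mono (union_subset ?_ ?_)
          · exact fun x hx => ⟨hx.1.1, by rw [mem_preimage, hbr ha x hx.1]; exact hx.2⟩
          · exact fun x hx => ⟨hx.1.1, by rw [mem_preimage, hbr hb x hx.1]; exact hx.2⟩
      _ = volume V := T.volume_preimage_That hβ hA hVX hVm.nullMeasurableSet
  have hlt : volume V ≠ ∞ := ((measure_mono hVX).trans_lt (T.volume_Xhat_lt_top hβ hA)).ne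
  by_contra h0
  exact hsum.not_gt (ENNReal.lt_add_right hlt h0)

theorem volume_overlap (hβ : IsPisotUnit β) (hA : ∀ a ∈ T.A, a ∈ QBeta β) :
    volume T.overlap = 0 := by
  have hsub : T.overlap ⊆ ⋃ a ∈ T.A, ⋃ b ∈ T.A, ⋃ (_ : a ≠ b),
      (branch hβ a '' (T.Xhat ∩ proj β ⁻¹' T.piece a) ∩
        branch hβ b '' (T.Xhat ∩ proj β ⁻¹' T.piece b)) := by
    rintro y ⟨x, hx, x', hx', hne, hxy, hxy'⟩
    obtain ⟨h1, h2⟩ := T.digit_mem (T.proj_mem_of_mem_Xhat hβ hx)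
    obtain ⟨h1', h2'⟩ := T.digit_mem (T.proj_mem_of_mem_Xhat hβ hx')
    rw [T.That_eq_lift hβ hx] at hxy
    rw [T.That_eq_lift hβ hx'] at hxy'
    simp only [mem_iUnion]
    refine ⟨_, h1, _, h1', fun he => hne ?_, ⟨x, ⟨hx, h2⟩, hxy⟩, ⟨x', ⟨hx', h2'⟩, hxy'⟩⟩
    rw [lift] at hxy hxy'
    rw [← he] at hxy'
    exact (branch hβ _).injective (hxy.trans hxy'.symm)
  refine measure_mono_null hsub ?_
  refine (measure_biUnion_null_iff T.A.countable_toSet).2 fun a ha => ?_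
  refine (measure_biUnion_null_iff T.A.countable_toSet).2 fun b hb => ?_
  exact measure_iUnion_null fun hab => T.volume_branch_image_inter hβ hA ha hb hab

/-! ### The exceptional sets -/

/-- `D` is the zero set in `X` of the density of `μ` with respect to Lebesgue measure. Off `D`, sets
that are `μ`-null are Lebesgue null; this matters because `M` has to be Lebesgue measurable, not
merely measurable for the completion of `μ`. -/
theorem exists_measurableSet_null_fiber (hβ : IsPisotUnit β) (hA : ∀ a ∈ T.A, a ∈ QBeta β) :
    ∃ D ⊆ T.X, MeasurableSet D ∧ volume (T.Xhat ∩ proj β ⁻¹' D) = 0 ∧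
      ∀ B ⊆ T.X \ D, MeasurableSet B → volume (T.Xhat ∩ proj β ⁻¹' B) = 0 → volume B = 0 := by
  have hpm := (continuous_proj hβ.isIntegral).measurable
  set μ' : Measure ℝ := Measure.map (proj β) (volume.restrict T.Xhat) with hμ'
  have : IsFiniteMeasure (volume.restrict T.Xhat) :=
    isFiniteMeasure_restrict.2 (T.volume_Xhat_lt_top hβ hA).ne
  have hac : μ' ≪ volume := (Measure.restrict_le_self.absolutelyContinuous.map hpm).trans
    (quasiMeasurePreserving_proj hβ.isIntegral).absolutelyContinuous
  set ρ := μ'.rnDeriv volume with hρ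
  have hρm : Measurable ρ := Measure.measurable_rnDeriv _ _
  have hμ'B : ∀ B, MeasurableSet B →
      (volume (T.Xhat ∩ proj β ⁻¹' B) = 0 ↔ volume ({x | ρ x ≠ 0} ∩ B) = 0) := by
    intro B hB
    rw [← withDensity_apply_eq_zero hρm, hρ, Measure.withDensity_rnDeriv_eq _ _ hac, hμ',
      Measure.map_apply hpm hB, Measure.restrict_apply (hpm hB), inter_comm]
  have hDm : MeasurableSet (T.X ∩ {x | ρ x = 0}) :=
    T.measurableSet_X.inter (hρm (measurableSet_singleton 0))
  refine ⟨T.X ∩ {x | ρ x = 0}, inter_subset_left, hDm, ?_, fun B hB hBm h0 => ?_⟩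
  · rw [hμ'B _ hDm]
    convert measure_empty (μ := (volume : Measure ℝ))
    ext x
    simp only [mem_inter_iff, mem_ofPred_eq, mem_empty_iff_false, iff_false, not_and]
    exact fun h _ => h
  · rw [hμ'B _ hBm] at h0
    have hsub : B ⊆ {x | ρ x ≠ 0} ∩ B := fun x hx => ⟨fun h => (hB hx).2 ⟨(hB hx).1, h⟩, hx⟩
    exact measure_mono_null hsub h0

/-- Lebesgue measurability of the set of points of `X` whose fiber is contained in a null set,
as soon as this null set contains all fibers over a suitable set `D`. -/
theorem nullMeasurableSet_diff_proj_image (hβ : IsPisotUnit β) (hA : ∀ a ∈ T.A, a ∈ QBeta β)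
    {D : Set ℝ} (hDX : D ⊆ T.X) (hD : MeasurableSet D)
    (hpos : ∀ B ⊆ T.X \ D, MeasurableSet B → volume (T.Xhat ∩ proj β ⁻¹' B) = 0 → volume B = 0)
    {N : Set (Fin (deg β) → ℝ)} (hN : volume N = 0) (hDN : T.Xhat ∩ proj β ⁻¹' D ⊆ N) :
    NullMeasurableSet (T.X \ proj β '' (T.Xhat \ N)) := by
  have hfin := T.volume_Xhat_lt_top hβ hA
  obtain ⟨K, hK, hKs, hK0⟩ := exists_isCompact_seq_subset (ν := volume) (V := T.Xhat \ N)
    ((T.measurableSet_Xhat hβ hA).nullMeasurableSet.diff (NullMeasurableSet.of_null hN))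
    ((measure_mono sdiff_subset).trans_lt hfin).ne
  -- `Q` is a Borel set containing the set in question, which in turn contains `D`. The fibers over
  -- `Q \ D` lie in `N` up to a null set, so `Q \ D` is Lebesgue null.
  set Q := T.X \ ⋃ n, proj β '' K n with hQ
  have hQm : MeasurableSet Q := T.measurableSet_X.diff (MeasurableSet.iUnion fun n =>
    ((hK n).image (continuous_proj hβ.isIntegral)).measurableSet)
  have hQ0 : volume (Q \ D) = 0 := by
    refine hpos _ (sdiff_subset_sdiff_left sdiff_subset) (hQm.diff hD) ?_
    refine measure_mono_null (fun x hx => ?_) (measure_union_null hN hK0)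
    by_cases hxN : x ∈ N
    · exact Or.inl hxN
    · refine Or.inr ⟨⟨hx.1, hxN⟩, fun hxK => hx.2.1.2 ?_⟩
      obtain ⟨n, hn⟩ := mem_iUnion.1 hxK
      exact mem_iUnion.2 ⟨n, x, hn, rfl⟩
  have hDM : D ⊆ T.X \ proj β '' (T.Xhat \ N) := by
    refine fun t ht => ⟨hDX ht, ?_⟩
    rintro ⟨x, ⟨hx, hxN⟩, rfl⟩
    exact hxN (hDN ⟨hx, ht⟩)
  have hMQ : T.X \ proj β '' (T.Xhat \ N) ⊆ Q := by
    refine sdiff_subset_sdiff_right (iUnion_subset fun n => image_mono (hKs n))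
  rw [← union_sdiff_cancel hDM]
  exact hD.nullMeasurableSet.union (NullMeasurableSet.of_null
    (measure_mono_null (sdiff_subset_sdiff_left hMQ) hQ0))

end RightContBetaTransformation

namespace RightContBetaTransformation

variable (T : RightContBetaTransformation β)

/-! ### Generation of the Lebesgue sets -/

/-- The points of `X` whose first `k` digits are `w` and for which `2 ^ k T^k x` has integer part
`m`. -/
def cylinder (k : ℕ) (w : Fin k → T.A) (m : ℤ) : Set ℝ :=
  {x | x ∈ T.X ∧ (∀ i : Fin k, T.expansion x i = w i) ∧ ⌊2 ^ k * T.map^[k] x⌋ = m}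

theorem measurableSet_cylinder (k : ℕ) (w : Fin k → T.A) (m : ℤ) :
    MeasurableSet (T.cylinder k w m) := by
  have hit : ∀ n, Measurable T.map^[n] := fun n => T.measurable_map.iterate n
  have : T.cylinder k w m = T.X ∩ ((⋂ i : Fin k, (T.digit ∘ T.map^[i]) ⁻¹' {(w i : ℝ)}) ∩
      (fun x => ⌊2 ^ k * T.map^[k] x⌋) ⁻¹' {m}) := by
    ext x
    simp only [cylinder, expansion, mem_ofPred_eq, mem_inter_iff, mem_iInter, mem_preimage,
      Function.comp_apply, mem_singleton_iff]
  rw [this]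
  refine T.measurableSet_X.inter ((MeasurableSet.iInter fun i => ?_).inter ?_)
  · exact (T.measurable_digit.comp (hit i)) (measurableSet_singleton _)
  · exact (Int.measurable_floor.comp ((hit k).const_mul _)) (measurableSet_singleton m)

theorem proj_That_iterate (hβ : IsPisotUnit β) (hA : ∀ a ∈ T.A, a ∈ QBeta β) (n : ℕ)
    {x : Fin (deg β) → ℝ} (hx : x ∈ T.Xhat) :
    proj β (T.That^[n] x) = T.map^[n] (proj β x) := by
  induction n with
  | zero => rfl
  | succ n ih =>
    rw [Function.iterate_succ_apply', Function.iterate_succ_apply',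
      T.proj_That hβ hA ((T.mapsTo_That hβ hA).iterate n hx), ih]

theorem That_iterate_sub (hβ : IsPisotUnit β) (hA : ∀ a ∈ T.A, a ∈ QBeta β) (n : ℕ)
    {x y : Fin (deg β) → ℝ} (hx : x ∈ T.Xhat) (hy : y ∈ T.Xhat)
    (h : ∀ i < n, T.expansion (proj β x) i = T.expansion (proj β y) i) :
    T.That^[n] x - T.That^[n] y = companion β ^ n *ᵥ (x - y) := by
  induction n with
  | zero => simp
  | succ n ih =>
    have hm := (T.mapsTo_That hβ hA).iterate n
    have h1 := h n (Nat.lt_succ_self n)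
    simp only [expansion, ← T.proj_That_iterate hβ hA n hx,
      ← T.proj_That_iterate hβ hA n hy] at h1
    rw [Function.iterate_succ_apply', Function.iterate_succ_apply', T.That_eq_lift hβ (hm hx),
      T.That_eq_lift hβ (hm hy), lift, lift, h1, branch_apply, branch_apply, sub_sub_sub_cancel_right,
      ← Matrix.mulVec_sub, ih fun i hi => h i (hi.trans (Nat.lt_succ_self n)), pow_succ',
      Matrix.mulVec_mulVec]

/-- Equal first `k` digits make the difference after `k` steps equal to `M_β^k (x - y)`, which is
small along `H`. Along `v_1` that difference is expanded, and there the floor condition bounds it by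
`2^(-k)`. -/
theorem exists_small_cylinder_image (hβ : IsPisotUnit β) (hA : ∀ a ∈ T.A, a ∈ QBeta β) {ε : ℝ}
    (hε : 0 < ε) : ∃ k : ℕ, ∀ w m, ∀ x ∈ T.Xhat ∩ proj β ⁻¹' T.cylinder k w m,
      ∀ y ∈ T.Xhat ∩ proj β ⁻¹' T.cylinder k w m, dist (T.That^[k] x) (T.That^[k] y) < ε := by
  have := finite_emb hβ.isIntegral
  obtain ⟨R, -, hR⟩ := T.exists_isTrapRadius hβ 0
  obtain ⟨C, hC, hCb⟩ := exists_norm_le_of_coord hβ.isIntegral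
  set δ := ε / (2 * C) with hδ
  have hδ0 : 0 < δ := by positivity
  have h1 : ∀ᶠ k : ℕ in Filter.atTop, (1 / 2 : ℝ) ^ k < δ :=
    (tendsto_pow_atTop_nhds_zero_of_lt_one (by norm_num) (by norm_num)).eventually_lt_const hδ0
  have h2 : ∀ᶠ k : ℕ in Filter.atTop, ∀ j : Emb β, j ≠ emb₁ β →
      ‖conj β j‖ ^ k * (R + R) < δ := by
    rw [Filter.eventually_all]
    intro j
    by_cases hj : j = emb₁ β
    · exact Filter.Eventually.of_forall fun k h => absurd hj h
    · have := (tendsto_pow_atTop_nhds_zero_of_lt_one (norm_nonneg _)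
        (norm_conj_lt_one hβ hj)).mul_const (R + R)
      rw [zero_mul] at this
      filter_upwards [this.eventually_lt_const hδ0] with k hk _ using hk
  obtain ⟨k, hk1, hk2⟩ := (h1.and h2).exists
  refine ⟨k, fun w m x hx y hy => ?_⟩
  have hsub := T.That_iterate_sub hβ hA k hx.1 hy.1
    fun i hi => (hx.2.2.1 ⟨i, hi⟩).trans (hy.2.2.1 ⟨i, hi⟩).symm
  have hlt : C * δ < ε := by
    rw [hδ]; field_simp; linarith
  rw [dist_eq_norm]
  refine (hCb δ _ fun j => ?_).trans_lt hlt
  by_cases hj : j = emb₁ β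
  · rw [hj, ← ofReal_proj, Complex.norm_real, proj_eq_re hβ.isIntegral, map_sub, Complex.sub_re,
      ← proj_eq_re, ← proj_eq_re, T.proj_That_iterate hβ hA k hx.1,
      T.proj_That_iterate hβ hA k hy.1, Real.norm_eq_abs]
    have h3 := Int.abs_sub_lt_one_of_floor_eq_floor (hx.2.2.2.trans hy.2.2.2.symm)
    rw [← mul_sub, abs_mul, abs_of_pos (by positivity : (0 : ℝ) < 2 ^ k)] at h3
    refine le_trans ?_ hk1.le
    rw [one_div, inv_pow, ← one_div, le_div_iff₀ (by positivity), mul_comm]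
    exact h3.le
  · rw [hsub, coord_pow_mulVec, norm_mul, norm_pow]
    refine le_trans ?_ (hk2 j hj).le
    gcongr
    rw [map_sub]
    exact (norm_sub_le _ _).trans (add_le_add ((T.Xhat_subset_trap hβ hA hR hx.1).2 j hj)
      ((T.Xhat_subset_trap hβ hA hR hy.1).2 j hj))

/-- The `σ`-algebra `⋁_{k ≥ 0} T̂^k π⁻¹ 𝓑` with `π` and `T̂` restricted to `Y`. -/
@[reducible] def join (Y : Set (Fin (deg β) → ℝ)) : MeasurableSpace (Fin (deg β) → ℝ) :=
  joinSigma (E := LebSpace (deg β)) (F := LebLine) Y T.That T.X (proj β)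

theorem measurableSet_join_image (Y : Set (Fin (deg β) → ℝ)) (k : ℕ) {B : Set ℝ}
    (hBX : B ⊆ T.X) (hB : MeasurableSet B) :
    MeasurableSet[T.join Y]
      (T.That^[k] '' (Y ∩ proj β ⁻¹' B)) :=
  MeasurableSpace.measurableSet_generateFrom ⟨k, B, hBX, hB.nullMeasurableSet, rfl⟩

/-- Every point of `Y` is `T̂^k` of a point of `Y` for every `k`, so it lies in arbitrarily small
cylinder images. There are only countably many cylinders, so those whose image fits in `U` exhaust
`U ∩ Y`. -/
theorem measurableSet_join_open (hβ : IsPisotUnit β) (hA : ∀ a ∈ T.A, a ∈ QBeta β)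
    {Y U : Set (Fin (deg β) → ℝ)} (hYX : Y ⊆ T.Xhat) (hY : BijOn T.That Y Y) (hU : IsOpen U) :
    MeasurableSet[T.join Y]
      (U ∩ Y) := by
  have key : U ∩ Y = ⋃ (k : ℕ) (w : Fin k → T.A) (m : ℤ)
      (_ : T.That^[k] '' (Y ∩ proj β ⁻¹' T.cylinder k w m) ⊆ U),
      T.That^[k] '' (Y ∩ proj β ⁻¹' T.cylinder k w m) := by
    apply Subset.antisymm
    · rintro p ⟨hpU, hpY⟩
      obtain ⟨ε, hε, hball⟩ := Metric.isOpen_iff.1 hU p hpU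
      obtain ⟨k, hk⟩ := T.exists_small_cylinder_image hβ hA hε
      obtain ⟨x, hx, rfl⟩ := (hY.surjOn.iterate k) hpY
      have hxX := T.proj_mem_of_mem_Xhat hβ (hYX hx)
      set w : Fin k → T.A := fun i =>
        ⟨T.expansion (proj β x) i, (T.digit_mem (T.mapsTo_map.iterate i hxX)).1⟩
      have hxc : proj β x ∈ T.cylinder k w ⌊2 ^ k * T.map^[k] (proj β x)⌋ :=
        ⟨hxX, fun i => rfl, rfl⟩
      simp only [mem_iUnion]
      refine ⟨k, w, _, ?_, x, ⟨hx, hxc⟩, rfl⟩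
      rintro _ ⟨y, hy, rfl⟩
      exact hball (hk w _ y ⟨hYX hy.1, hy.2⟩ x ⟨hYX hx, hxc⟩)
    · refine iUnion_subset fun k => iUnion_subset fun w => iUnion_subset fun m =>
        iUnion_subset fun h => subset_inter h ?_
      exact ((hY.mapsTo.iterate k).mono_left inter_subset_left).image_subset
  rw [key]
  refine MeasurableSet.iUnion fun k => MeasurableSet.iUnion fun w => MeasurableSet.iUnion fun m =>
    MeasurableSet.iUnion fun _ => ?_
  exact T.measurableSet_join_image Y k (fun x hx => hx.1) (T.measurableSet_cylinder k w m)

theorem measurableSet_join_inter (hβ : IsPisotUnit β) (hA : ∀ a ∈ T.A, a ∈ QBeta β)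
    {Y V : Set (Fin (deg β) → ℝ)} (hYX : Y ⊆ T.Xhat) (hY : BijOn T.That Y Y)
    (hV : MeasurableSet V) :
    MeasurableSet[T.join Y]
      (V ∩ Y) := by
  -- `Y` itself belongs to the join, which relative complements require.
  have hYm := T.measurableSet_join_open hβ hA hYX hY isOpen_univ
  rw [univ_inter] at hYm
  induction V, hV using MeasurableSet.induction_on_open with
  | isOpen U hU => exact T.measurableSet_join_open hβ hA hYX hY hU
  | compl t ht ih =>
    have : tᶜ ∩ Y = Y \ (t ∩ Y) := by ext x; simp; tauto
    rw [this]
    exact MeasurableSet.diff hYm ih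
  | iUnion f _ _ ih =>
    rw [iUnion_inter]
    exact MeasurableSet.iUnion ih

/-- The generators are Lebesgue measurable because forward images under `T̂` preserve Lebesgue
measurability. -/
theorem nullMeasurableSet_of_join (hβ : IsPisotUnit β)
    {Y G : Set (Fin (deg β) → ℝ)} (hYX : Y ⊆ T.Xhat) (hY : MapsTo T.That Y Y)
    (hYm : NullMeasurableSet Y)
    (hG : MeasurableSet[T.join Y] G) :
    NullMeasurableSet G := by
  have himage : ∀ (k : ℕ) (B : Set ℝ), NullMeasurableSet B →
      NullMeasurableSet (T.That^[k] '' (Y ∩ proj β ⁻¹' B)) := by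
    intro k B hB
    have hs : ∀ k : ℕ, T.That^[k] '' (Y ∩ proj β ⁻¹' B) ⊆ T.Xhat := fun k =>
      Subset.trans ((hY.iterate k).mono_left inter_subset_left).image_subset hYX
    induction k with
    | zero =>
      simpa using hYm.inter (hB.preimage (quasiMeasurePreserving_proj hβ.isIntegral))
    | succ k ih =>
      rw [Function.iterate_succ', image_comp]
      exact T.nullMeasurableSet_That_image hβ (hs k) ih
  have hle : T.join Y ≤ (inferInstance : MeasurableSpace (LebSpace (deg β))) := by
    refine MeasurableSpace.generateFrom_le ?_
    rintro _ ⟨k, B, -, hB, rfl⟩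
    exact himage k B hB
  exact hle _ hG

/-! ### The natural extension -/

theorem measurable_proj_lebSpace (hβ : IsPisotUnit β) :
    Measurable (α := LebSpace (deg β)) (β := LebLine) (proj β) := fun B hB =>
  NullMeasurableSet.preimage (s := (B : Set ℝ)) hB (quasiMeasurePreserving_proj hβ.isIntegral)

theorem mu_apply (hβ : IsPisotUnit β) {B : Set ℝ} (hB : NullMeasurableSet B) :
    T.mu B = volume (T.Xhat ∩ proj β ⁻¹' B) := by
  have h1 : T.mu B = ((leb (deg β)).restrict T.Xhat) (proj β ⁻¹' B) :=
    Measure.map_apply (measurable_proj_lebSpace hβ) (show MeasurableSet (α := LebLine) B from hB)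
  have h2 : ((leb (deg β)).restrict T.Xhat) (proj β ⁻¹' B) = leb (deg β) (proj β ⁻¹' B ∩ T.Xhat) :=
    Measure.restrict_apply (measurable_proj_lebSpace hβ hB)
  rw [h1, h2, inter_comm]
  rfl

theorem nullMeasurableSet_proj_preimage (hβ : IsPisotUnit β) {B : Set ℝ}
    (hB : NullMeasurableSet B) : NullMeasurableSet (proj β ⁻¹' B) :=
  hB.preimage (quasiMeasurePreserving_proj hβ.isIntegral)

theorem isSystem_That (hβ : IsPisotUnit β) (hA : ∀ a ∈ T.A, a ∈ QBeta β) :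
    IsSystem (E := LebSpace (deg β)) T.Xhat (leb (deg β)) T.That where
  measurableSet_carrier := (T.measurableSet_Xhat hβ hA).nullMeasurableSet
  measure_pos := T.volume_Xhat_pos hβ hA
  measure_lt_top := T.volume_Xhat_lt_top hβ hA
  mapsTo := T.mapsTo_That hβ hA
  measurable _ _ hB := T.nullMeasurableSet_preimage_That hβ hA hB
  measurePreserving _ hBX hB := T.volume_preimage_That hβ hA hBX hB

theorem Xhat_inter_proj_preimage_X (hβ : IsPisotUnit β) :
    T.Xhat ∩ proj β ⁻¹' T.X = T.Xhat :=
  inter_eq_left.2 fun _ hx => T.proj_mem_of_mem_Xhat hβ hx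

theorem mu_X (hβ : IsPisotUnit β) : T.mu T.X = volume T.Xhat := by
  rw [T.mu_apply hβ T.measurableSet_X.nullMeasurableSet, T.Xhat_inter_proj_preimage_X hβ]

/-- Invariance of `μ` descends from that of `λ^d` through the factor map. -/
theorem mu_preimage_map (hβ : IsPisotUnit β) (hA : ∀ a ∈ T.A, a ∈ QBeta β) {B : Set ℝ}
    (hB : NullMeasurableSet B) : T.mu (T.X ∩ T.map ⁻¹' B) = T.mu B := by
  refine (T.mu_apply hβ (T.nullMeasurableSet_preimage_map
    (zero_lt_one.trans hβ.one_lt).ne' hB)).trans (Eq.trans ?_ (T.mu_apply hβ hB).symm)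
  rw [← T.volume_preimage_That hβ hA (B := T.Xhat ∩ proj β ⁻¹' B) inter_subset_left
    ((T.measurableSet_Xhat hβ hA).nullMeasurableSet.inter
      (nullMeasurableSet_proj_preimage hβ hB))]
  congr 1
  ext x
  simp only [mem_inter_iff, mem_preimage]
  refine and_congr_right fun hx => ?_
  rw [T.proj_That hβ hA hx]
  exact ⟨fun h => ⟨T.mapsTo_That hβ hA hx, h.2⟩, fun h => ⟨T.proj_mem_of_mem_Xhat hβ hx, h.2⟩⟩

theorem isSystem_map (hβ : IsPisotUnit β) (hA : ∀ a ∈ T.A, a ∈ QBeta β) :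
    IsSystem (E := LebLine) T.X T.mu T.map where
  measurableSet_carrier := T.measurableSet_X.nullMeasurableSet
  measure_pos := (T.volume_Xhat_pos hβ hA).trans_eq (T.mu_X hβ).symm
  measure_lt_top := (T.mu_X hβ).trans_lt (T.volume_Xhat_lt_top hβ hA)
  mapsTo := T.mapsTo_map
  measurable _ _ hB := T.nullMeasurableSet_preimage_map (zero_lt_one.trans hβ.one_lt).ne' hB
  measurePreserving _ _ hB := T.mu_preimage_map hβ hA hB

/-- Two distinct points with a common image would put that image into `overlap`, hence into the
grand orbit. Surjectivity uses that preimages of points outside the grand orbit are outside it. -/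
theorem bijOn_That_diff_grandOrbit (hβ : IsPisotUnit β) (hA : ∀ a ∈ T.A, a ∈ QBeta β)
    {D : Set (Fin (deg β) → ℝ)} (hDX : D ⊆ T.Xhat) (hD : T.overlap ⊆ D) :
    BijOn T.That (T.Xhat \ grandOrbit T.Xhat T.That D)
      (T.Xhat \ grandOrbit T.Xhat T.That D) := by
  have hmaps := T.mapsTo_That hβ hA
  have hm : MapsTo T.That (T.Xhat \ grandOrbit T.Xhat T.That D)
      (T.Xhat \ grandOrbit T.Xhat T.That D) := fun x hx =>
    ⟨hmaps hx.1, fun h => hx.2 ((mem_grandOrbit_iff hmaps hx.1).1 h)⟩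
  refine ⟨hm, fun x hx y hy hxy => ?_, fun y hy => ?_⟩
  · by_contra hne
    exact (hm hx).2 (subset_grandOrbit hDX (hD ⟨x, hx.1, y, hy.1, hne, rfl, hxy.symm⟩))
  · obtain ⟨x, hx, rfl⟩ := (T.That_image_Xhat hβ hA).symm ▸ hy.1
    exact ⟨x, ⟨hx, fun h => hy.2 ((mem_grandOrbit_iff hmaps hx).2 h)⟩, rfl⟩

theorem exists_null_sets (hβ : IsPisotUnit β) (hA : ∀ a ∈ T.A, a ∈ QBeta β) :
    ∃ N ⊆ T.Xhat, ∃ M ⊆ T.X, volume N = 0 ∧ NullMeasurableSet M ∧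
      BijOn T.That (T.Xhat \ N) (T.Xhat \ N) ∧ proj β '' (T.Xhat \ N) = T.X \ M := by
  obtain ⟨D, hDX, hDm, hD0, hpos⟩ := T.exists_measurableSet_null_fiber hβ hA
  -- Removing `overlap` gives injectivity; removing the fibers over `D` makes the projection of what
  -- remains Lebesgue measurable. `M` is then defined as the complement of that projection, so `π`
  -- is onto by construction.
  set D' := T.overlap ∪ (T.Xhat ∩ proj β ⁻¹' D)
  have hD'X : D' ⊆ T.Xhat := union_subset (T.overlap_subset hβ hA) inter_subset_left
  have hN0 : volume (grandOrbit T.Xhat T.That D') = 0 := by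
    refine measure_grandOrbit (T.mapsTo_That hβ hA) (fun C hC h0 => ?_) (fun C hC h0 => ?_)
      hD'X (measure_union_null (T.volume_overlap hβ hA) hD0)
    · exact le_antisymm ((T.volume_That_image_le hβ hC (NullMeasurableSet.of_null h0)).trans
        h0.le) zero_le
    · rw [T.volume_preimage_That hβ hA hC (NullMeasurableSet.of_null h0), h0]
  refine ⟨grandOrbit T.Xhat T.That D', fun x hx => hx.1,
    T.X \ proj β '' (T.Xhat \ grandOrbit T.Xhat T.That D'), sdiff_subset, hN0,
    T.nullMeasurableSet_diff_proj_image hβ hA hDX hDm hpos hN0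
      (subset_union_right.trans (subset_grandOrbit hD'X)),
    T.bijOn_That_diff_grandOrbit hβ hA hD'X subset_union_left, ?_⟩
  rw [sdiff_sdiff_right_self]
  refine (inter_eq_right.2 ?_).symm
  rintro _ ⟨x, hx, rfl⟩
  exact T.proj_mem_of_mem_Xhat hβ hx.1

theorem nullMeasurableSet_iff_exists_join (hβ : IsPisotUnit β) (hA : ∀ a ∈ T.A, a ∈ QBeta β)
    {N : Set (Fin (deg β) → ℝ)} (hN0 : volume N = 0)
    (hbij : BijOn T.That (T.Xhat \ N) (T.Xhat \ N)) {C : Set (Fin (deg β) → ℝ)}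
    (hC : C ⊆ T.Xhat) : NullMeasurableSet C ↔
      ∃ G, MeasurableSet[T.join (T.Xhat \ N)] G ∧ volume (C ∆ (T.Xhat ∩ G)) = 0 := by
  have hXm := (T.measurableSet_Xhat hβ hA).nullMeasurableSet (μ := volume)
  constructor
  · rintro ⟨V, hV, hCV⟩
    -- `V` is a measurable set almost equal to `C`; cutting it down to `X̂ \ N` puts it in the join
    -- and changes it within `X̂` only on `N`.
    refine ⟨V ∩ (T.Xhat \ N), T.measurableSet_join_inter hβ hA sdiff_subset hbij hV, ?_⟩
    refine measure_mono_null (fun x hx => ?_)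
      (measure_union_null (measure_symmDiff_eq_zero_iff.2 hCV) hN0)
    by_cases hxN : x ∈ N
    · exact Or.inr hxN
    · left
      rcases hx with ⟨hxC, hxG⟩ | ⟨hxG, hxC⟩
      · exact Or.inl ⟨hxC, fun hxV => hxG ⟨hC hxC, hxV, hC hxC, hxN⟩⟩
      · exact Or.inr ⟨hxG.2.1, hxC⟩
  · rintro ⟨G, hG, hG0⟩
    have hGm := T.nullMeasurableSet_of_join hβ sdiff_subset hbij.mapsTo
      (hXm.diff (NullMeasurableSet.of_null hN0)) hG
    exact (hXm.inter hGm).congr (measure_symmDiff_eq_zero_iff.1 hG0).symm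

theorem mapsTo_map_of_proj_image (hβ : IsPisotUnit β) (hA : ∀ a ∈ T.A, a ∈ QBeta β)
    {Y : Set (Fin (deg β) → ℝ)} (hYX : Y ⊆ T.Xhat) (hY : MapsTo T.That Y Y) :
    MapsTo T.map (proj β '' Y) (proj β '' Y) := by
  rintro _ ⟨x, hx, rfl⟩
  exact ⟨T.That x, hY hx, T.proj_That hβ hA (hYX hx)⟩

/-- No point of `X̂ \ N` projects into `M`, so the part of `X̂` over `M` lies in `N`. -/
theorem mu_eq_zero_of_proj_image (hβ : IsPisotUnit β) {N : Set (Fin (deg β) → ℝ)} {M : Set ℝ}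
    (hN0 : volume N = 0) (hM : NullMeasurableSet M) (hNM : proj β '' (T.Xhat \ N) = T.X \ M) :
    T.mu M = 0 := by
  rw [T.mu_apply hβ hM]
  refine measure_mono_null (fun x hx => ?_) hN0
  by_contra hxN
  exact (hNM.subset ⟨x, ⟨hx.1, hxN⟩, rfl⟩).2 hx.2

theorem volume_diff_inter_proj_preimage (hβ : IsPisotUnit β) {N : Set (Fin (deg β) → ℝ)}
    (hN0 : volume N = 0) {B : Set ℝ} (hB : NullMeasurableSet B) :
    volume ((T.Xhat \ N) ∩ proj β ⁻¹' B) = T.mu B := by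
  rw [T.mu_apply hβ hB, sdiff_inter_right_comm]
  exact measure_sdiff_null hN0

theorem isNaturalExtension (hβ : IsPisotUnit β) (hA : ∀ a ∈ T.A, a ∈ QBeta β) :
    IsNaturalExtension (E := LebSpace (deg β)) (F := LebLine)
      T.Xhat (leb (deg β)) T.That T.X T.mu T.map (proj β) := by
  obtain ⟨N, hNX, M, hMX, hN0, hMm, hbij, hNM⟩ := T.exists_null_sets hβ hA
  have hNm : NullMeasurableSet N volume := NullMeasurableSet.of_null hN0
  have hYm : NullMeasurableSet (T.Xhat \ N) volume :=
    (T.measurableSet_Xhat hβ hA).nullMeasurableSet.diff hNm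
  exact ⟨T.isSystem_That hβ hA, T.isSystem_map hβ hA, N, hNX, M, hMX, hNm, hMm, hN0,
    T.mu_eq_zero_of_proj_image hβ hN0 hMm hNM, hbij.mapsTo,
    hNM ▸ T.mapsTo_map_of_proj_image hβ hA sdiff_subset hbij.mapsTo, hNM,
    fun B _ hB => ⟨hYm.inter (nullMeasurableSet_proj_preimage hβ (B := B) hB),
      T.volume_diff_inter_proj_preimage hβ hN0 hB⟩,
    fun y hy => T.proj_That hβ hA hy.1, hbij,
    fun C hC hCm => T.nullMeasurableSet_That_image hβ (hC.trans sdiff_subset) hCm,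
    fun C hC => T.nullMeasurableSet_iff_exists_join hβ hA hN0 hbij hC⟩

theorem pairwiseDisjoint_XhatPiece (hβ : IsPisotUnit β) :
    (T.A : Set ℝ).PairwiseDisjoint T.XhatPiece := by
  intro a _ b _ hab
  refine Set.disjoint_left.2 fun x hxa hxb => hab ?_
  rw [← ((T.mem_XhatPiece_iff hβ).1 hxa).2, ((T.mem_XhatPiece_iff hβ).1 hxb).2]

theorem iUnion_XhatPiece (hβ : IsPisotUnit β) : ⋃ a ∈ T.A, T.XhatPiece a = T.Xhat := by
  ext x
  simp only [mem_iUnion, T.mem_XhatPiece_iff hβ]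
  constructor
  · rintro ⟨a, -, hx, -⟩
    exact hx
  · exact fun hx => ⟨_, (T.digit_mem (T.proj_mem_of_mem_Xhat hβ hx)).1, hx, rfl⟩

theorem That_of_mem_XhatPiece (hβ : IsPisotUnit β) {a : ℝ} {x : Fin (deg β) → ℝ}
    (hx : x ∈ T.XhatPiece a) : T.That x = companion β *ᵥ x - Psi β a := by
  obtain ⟨hx', rfl⟩ := (T.mem_XhatPiece_iff hβ).1 hx
  rw [T.That_eq_lift hβ hx', lift, branch_apply]

end RightContBetaTransformation

end BetaNatExt

end

theorem theoremt (β : ℝ) (hβ : BetaNatExt.IsPisotUnit β)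
    (T : BetaNatExt.RightContBetaTransformation β)
    (hA : ∀ a ∈ T.A, a ∈ BetaNatExt.QBeta β) :
    -- the sets `X̂_a` partition `X̂`, so that `T̂` is well defined
    (T.A : Set ℝ).PairwiseDisjoint T.XhatPiece ∧ (⋃ a ∈ T.A, T.XhatPiece a) = T.Xhat ∧
    (∀ a ∈ T.A, ∀ x ∈ T.XhatPiece a,
      T.That x = (BetaNatExt.companion β).mulVec x - BetaNatExt.Psi β a) ∧
    -- `(X̂, Lebesgue sets, λ^d, T̂)` is a natural extension of `(X, Lebesgue sets, μ, T)`
    BetaNatExt.IsNaturalExtension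
      (E := BetaNatExt.LebSpace (BetaNatExt.deg β)) (F := BetaNatExt.LebLine)
      T.Xhat (BetaNatExt.leb (BetaNatExt.deg β)) T.That T.X T.mu T.map
      (BetaNatExt.proj β) := by
  exact ⟨T.pairwiseDisjoint_XhatPiece hβ, T.iUnion_XhatPiece hβ,
    fun _ _ _ hx => T.That_of_mem_XhatPiece hβ hx, T.isNaturalExtension hβ hA⟩
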